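/- Let $S^1=\{z\in\mathbb C:|z|=1\}$ and $\mathbb D=\{z\in\mathbb C:|z|<1\}$. Definitions. Bounded operators $X,Y$ on a Hilbert space $H$ are boolean independent with respect to a normal state $\varphi$ on $\mathcal B(H)$ if $$\varphi(X^{n_1}Y^{m_1}\cdots X^{n_k}Y^{m_k})=\prod_{\ell=1}^k\varphi(X^{n_\ell})\varphi(Y^{m_\ell})$$ for all $k\ge1$, $n_1,m_k\ge0$ and $n_2,\dots,n_k,m_1,\dots,m_{k-1}\ge1$. The distribution in the state $\varphi$ of a unitary operator $U$ is the unique probability measure $\mu$ on $S^1$ with $\varphi(U^k)=\int_{S^1}x^k\,d\mu(x)$ for all $k\in\mathbb N$. The multiplicative boolean convolution of two probability measures $\mu,\nu$ on $S^1$ is the distribution of $UV$, where $U,V$ are unitary operators with distributions $\mu,\nu$ in a normal state $\varphi$ such that $U-1$ and $V-1$ are boolean independent with respect to $\varphi$ (it depends only on $\mu$ and $\nu$). A probability measure $\mu$ on $S^1$ is infinitely divisible for the multiplicative boolean convolution if for every integer $n\ge1$ there is a probability measure $\mu_n$ on $S^1$ whose $n$-fold multiplicative boolean convolution with itself is $\mu$.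 For a probability measure $\mu$ on $S^1$ put $$\psi_\mu(z)=\int_{S^1}\frac{xz}{1-xz}\,d\mu(x),\qquad F_\mu(z)=\frac1z\,\frac{\psi_\mu(z)}{1+\psi_\mu(z)},\qquad z\in\mathbb D,$$ where $F_\mu(0)$ is defined by analytic extension, i.e. $F_\mu(0)=\lim_{z\to0}F_\mu(z)$. Theorem. Let $\mu$ be a probability measure on $S^1$ different from the Haar probability measure. Then $\mu$ is infinitely divisible for the multiplicative boolean convolution if and only if there exist a real number $b\in[0,2\pi)$ and a finite (positive Borel) measure $\rho$ on $S^1$ such that, for all $z\in\mathbb D$, $$F_\mu(z)=\exp\big(u(z)\big),\qquad u(z)=ib-\int_{S^1}\frac{x+z}{x-z}\,d\rho(x).$$ The pair $(b,\rho)$, called the characteristic pair of $\mu$, is uniquely determined by $\mu$: at most one such pair exists. -/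

import Mathlib

open MeasureTheory Filter Topology

noncomputable section

namespace BooleanUnitCircle

/-- The unit circle carries its Borel σ-algebra. -/
instance instMeasurableSpaceCircle : MeasurableSpace Circle := borel Circle

instance instBorelSpaceCircle : BorelSpace Circle := ⟨rfl⟩

section Operators

variable {H : Type} [NormedAddCommGroup H] [InnerProductSpace ℂ H]

/-- `φ` is a normal state on `B(H)`: it is `X ↦ Tr (D X)` for a density operator `D`, that is,
`φ X = ∑ n, ⟪ξ n, X (ξ n)⟫` for a sequence of vectors with `∑ n, ‖ξ n‖ ^ 2 = 1`. -/
def IsNormalState (φ : (H →L[ℂ] H) →ₗ[ℂ] ℂ) : Prop :=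
  ∃ ξ : ℕ → H, HasSum (fun n => ‖ξ n‖ ^ 2) 1 ∧
    ∀ X : H →L[ℂ] H, HasSum (fun n => inner ℂ (ξ n) (X (ξ n))) (φ X)

/-- `X` and `Y` are boolean independent with respect to `φ`:
`φ (X ^ n₁ Y ^ m₁ ⋯ X ^ n_k Y ^ m_k) = ∏ φ (X ^ n_l) φ (Y ^ m_l)` whenever all the exponents
except possibly the first one `n₁` and the last one `m_k` are at least `1`. -/
def BooleanIndependent (φ : (H →L[ℂ] H) →ₗ[ℂ] ℂ) (X Y : H →L[ℂ] H) : Prop :=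
  ∀ (k : ℕ) (n m : Fin k → ℕ),
    (∀ l : Fin k, 0 < (l : ℕ) → 1 ≤ n l) →
    (∀ l : Fin k, (l : ℕ) + 1 < k → 1 ≤ m l) →
    φ (List.ofFn fun l => X ^ n l * Y ^ m l).prod = ∏ l, φ (X ^ n l) * φ (Y ^ m l)

/-- The probability measure `μ` on the unit circle is the distribution of the unitary operator
`U` in the state `φ`. -/
def HasDistribution (φ : (H →L[ℂ] H) →ₗ[ℂ] ℂ) (U : H →L[ℂ] H) (μ : Measure Circle) : Prop :=
  IsProbabilityMeasure μ ∧ ∀ k : ℕ, φ (U ^ k) = ∫ x : Circle, (x : ℂ) ^ k ∂μ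

end Operators

/-- `κ` is the multiplicative boolean convolution of `μ` and `ν`: there are a Hilbert space, a
normal state on its bounded operators, and unitary operators `U`, `V` with distributions `μ`,
`ν`, such that `U - 1` and `V - 1` are boolean independent and `U V` has distribution `κ`. -/
def IsBooleanConv (μ ν κ : Measure Circle) : Prop :=
  ∃ (H : Type) (_ : NormedAddCommGroup H) (_ : InnerProductSpace ℂ H) (_ : CompleteSpace H)
    (φ : (H →L[ℂ] H) →ₗ[ℂ] ℂ) (U V : H →L[ℂ] H),
    IsNormalState φ ∧ U ∈ unitary (H →L[ℂ] H) ∧ V ∈ unitary (H →L[ℂ] H) ∧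
    HasDistribution φ U μ ∧ HasDistribution φ V ν ∧
    BooleanIndependent φ (U - 1) (V - 1) ∧ HasDistribution φ (U * V) κ

/-- `IsBooleanPower ν n κ`: the measure `κ` is the boolean convolution of `n ≥ 1` copies
of `ν`. -/
inductive IsBooleanPower (ν : Measure Circle) : ℕ → Measure Circle → Prop
  | one : IsBooleanPower ν 1 ν
  | succ {n : ℕ} {κ κ' : Measure Circle} :
      IsBooleanPower ν n κ → IsBooleanConv κ ν κ' → IsBooleanPower ν (n + 1) κ'

/-- Infinite divisibility with respect to the multiplicative boolean convolution. -/
def IsInfinitelyDivisible (μ : Measure Circle) : Prop :=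
  ∀ n : ℕ, 1 ≤ n → ∃ ν : Measure Circle, IsProbabilityMeasure ν ∧ IsBooleanPower ν n μ

/-- The Haar probability measure on the unit circle. -/
def haarCircle : Measure Circle := Measure.haarMeasure ⊤

/-- `ψ_μ(z) = ∫ x z / (1 - x z) dμ(x)`. -/
def psi (μ : Measure Circle) (z : ℂ) : ℂ := ∫ x : Circle, (x * z) / (1 - x * z) ∂μ

/-- The formula `(1 / z) * (ψ_μ(z) / (1 + ψ_μ(z)))`, meaningful for `0 < |z| < 1`. -/
def preF (μ : Measure Circle) (z : ℂ) : ℂ := 1 / z * (psi μ z / (1 + psi μ z))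

/-- The transform `F_μ` on the unit disk; its value at `0` is that of the analytic extension,
the limit of the formula at `0`. -/
def F (μ : Measure Circle) : ℂ → ℂ :=
  Function.update (preF μ) 0 (limUnder (𝓝[≠] 0) (preF μ))

/-- `u(z) = i b - ∫ (x + z) / (x - z) dρ(x)`. -/
def levyExponent (b : ℝ) (ρ : Measure Circle) (z : ℂ) : ℂ :=
  Complex.I * b - ∫ x : Circle, ((x : ℂ) + z) / (x - z) ∂ρ

/-- `(b, ρ)` is a characteristic pair of `μ`: `b ∈ [0, 2π)`, `ρ` is a finite measure on the unit
circle, and `F_μ = exp u` on the open unit disk. -/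
def IsCharacteristicPair (μ : Measure Circle) (b : ℝ) (ρ : Measure Circle) : Prop :=
  b ∈ Set.Ico 0 (2 * Real.pi) ∧ IsFiniteMeasure ρ ∧
    ∀ z : ℂ, ‖z‖ < 1 → F μ z = Complex.exp (levyExponent b ρ z)

end BooleanUnitCircle

end

noncomputable section

namespace BooleanUnitCircle

/-! The transform `F` identifies probability measures on the circle, under multiplicative boolean
convolution, with the multiplicative semigroup of analytic functions on the disc bounded by 1. Haar
measure corresponds to the zero function.

Everything rests on the identity `∫ 1 / (1 - x z) dμ(x) = 1 / (1 - z F_μ(z))`. The left side has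
real part at least 1/2, so `z F_μ(z)` has modulus at most 1, and the Schwarz lemma gives `|F_μ| ≤
1`. Conversely, for an analytic `G` with `|G| ≤ 1`, the Herglotz theorem applied to `(1 + z G) / (1
- z G)` produces a measure with transform `G` (`exists_measure_F_eq`). Multiplicativity comes from
computing the expectation of the resolvent of `U V` (`hasSum_moments_mul`). A boolean product of
multiplication operators realises every product of transforms as a convolution
(`isBooleanConv_of_F_eq_mul`).

In the function semigroup, infinite divisibility means having bounded analytic roots of all orders.
A zero of `F_μ` would then have infinite order, forcing `F_μ = 0` and `μ` Haar. Otherwise `F_μ = exp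
g` with `Re g ≤ 0`, and the Herglotz representation of `-g` gives the pair. In the other direction,
`exp (t u)` is bounded by 1 for every `t ≥ 0`, which supplies all the roots. For uniqueness, the
difference of two exponents is a constant in `2πi ℤ`, and the range of `b` makes it zero. -/

/-! ### Moments and generating functions of measures on the circle -/

lemma integrable_of_continuous {ρ : Measure Circle} [IsFiniteMeasure ρ] {f : Circle → ℂ}
    (hf : Continuous f) : Integrable f ρ :=
  hf.integrable_of_hasCompactSupport (HasCompactSupport.of_compactSpace f)

/-- Finite measures on the circle with the same nonnegative moments are equal. -/
theorem ext_of_moments {ρ ρ' : Measure Circle} [IsFiniteMeasure ρ] [IsFiniteMeasure ρ']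
    (h : ∀ k : ℕ, ∫ x : Circle, (x : ℂ) ^ k ∂ρ = ∫ x : Circle, (x : ℂ) ^ k ∂ρ') : ρ = ρ' := by
  have hz : ∀ k : ℤ, ∫ x : Circle, (x : ℂ) ^ k ∂ρ = ∫ x : Circle, (x : ℂ) ^ k ∂ρ' := by
    have key : ∀ (τ : Measure Circle) (k : ℕ), ∫ x : Circle, (x : ℂ) ^ (-(k : ℤ)) ∂τ =
        (starRingEnd ℂ) (∫ x : Circle, (x : ℂ) ^ k ∂τ) := by
      intro τ k
      rw [← integral_conj]
      refine integral_congr_ae (.of_forall fun x => ?_)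
      simp only [zpow_neg, zpow_natCast, map_pow, ← Circle.coe_inv_eq_conj, Circle.coe_inv, inv_pow]
    intro k
    obtain ⟨n, rfl | rfl⟩ := k.eq_nat_or_neg
    · simpa using h n
    · rw [key, key, h]
  let f : BoundedContinuousFunction Circle ℂ :=
    BoundedContinuousFunction.mkOfCompact ⟨fun x => (x : ℂ), by fun_prop⟩
  have hf : ∀ x, f x = (x : ℂ) := fun _ => rfl
  -- The coordinate function generates a point-separating star algebra, spanned by the integer
  -- powers of `x`.
  refine ext_of_forall_mem_subalgebra_integral_eq_of_polish (𝕜 := ℂ)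
    (A := StarAlgebra.adjoin ℂ {f}) ?_ ?_
  · intro x y hxy
    refine ⟨f, ⟨_, ⟨f, StarAlgebra.subset_adjoin ℂ _ rfl, rfl⟩, rfl⟩, ?_⟩
    simpa [hf, Circle.coe_inj] using hxy
  · intro g hg
    rw [← StarSubalgebra.mem_toSubalgebra, StarAlgebra.adjoin_toSubalgebra,
      ← Subalgebra.mem_toSubmodule, Algebra.adjoin_eq_span] at hg
    induction hg using Submodule.span_induction with
    | mem g hg =>
      have : ∃ k : ℤ, ∀ x : Circle, g x = (x : ℂ) ^ k := by
        induction hg using Submonoid.closure_induction with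
        | mem g hg =>
          rcases hg with hg | hg
          · rw [Set.mem_singleton_iff] at hg
            exact ⟨1, fun x => by simp [hg, hf]⟩
          · have hg' : g = star f := by
              rw [Set.mem_star, Set.mem_singleton_iff] at hg
              rw [← hg, star_star]
            refine ⟨-1, fun x => ?_⟩
            rw [hg', BoundedContinuousFunction.star_apply, hf, zpow_neg_one, ← Circle.coe_inv,
              Circle.coe_inv_eq_conj]
            rfl
        | one => exact ⟨0, fun x => by simp⟩
        | mul a b _ _ ha hb =>
          obtain ⟨k, hk⟩ := ha
          obtain ⟨l, hl⟩ := hb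
          exact ⟨k + l, fun x => by
            rw [BoundedContinuousFunction.mul_apply, hk, hl, zpow_add₀ x.coe_ne_zero]⟩
      obtain ⟨k, hk⟩ := this
      simp_rw [hk]
      exact hz k
    | zero => simp
    | add a b _ _ ha hb =>
      simp only [BoundedContinuousFunction.add_apply]
      rw [integral_add (integrable_of_continuous a.continuous)
        (integrable_of_continuous b.continuous), integral_add
        (integrable_of_continuous a.continuous) (integrable_of_continuous b.continuous), ha, hb]
    | smul c a _ ha =>
      simp only [BoundedContinuousFunction.smul_apply]
      rw [integral_smul, integral_smul, ha]

lemma norm_circle_mul_lt {x : Circle} {z : ℂ} (hz : ‖z‖ < 1) : ‖(x : ℂ) * z‖ < 1 := by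
  simpa [norm_mul, Circle.norm_coe] using hz

lemma one_sub_ne_zero_of_norm_lt {w : ℂ} (hw : ‖w‖ < 1) : 1 - w ≠ 0 := by
  intro h
  rw [← sub_eq_zero.1 h] at hw
  simp at hw

/-- The map `w ↦ 1 / (1 - w)` sends the unit disc into the half-plane `Re > 1/2`; all positivity
below comes from this. -/
lemma half_lt_re_inv_one_sub {w : ℂ} (hw : ‖w‖ < 1) : 1 / 2 < (1 / (1 - w)).re := by
  have h0 := one_sub_ne_zero_of_norm_lt hw
  have hp : 0 < Complex.normSq (1 - w) := Complex.normSq_pos.2 h0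
  rw [one_div (1 - w), Complex.inv_re, lt_div_iff₀ hp]
  have h1 : Complex.normSq w < 1 := by
    rw [Complex.normSq_eq_norm_sq]
    exact pow_lt_one₀ (norm_nonneg _) hw two_ne_zero
  rw [Complex.normSq_apply] at h1 ⊢
  simp only [Complex.sub_re, Complex.sub_im, Complex.one_re, Complex.one_im]
  nlinarith

/-- A power series on the unit disc with bounded coefficients. -/
lemma hasFPowerSeriesOnBall_of_hasSum {f : ℂ → ℂ} {a : ℕ → ℂ} {C : ℝ} (ha : ∀ k, ‖a k‖ ≤ C)
    (h : ∀ z : ℂ, ‖z‖ < 1 → HasSum (fun k => a k * z ^ k) (f z)) :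
    HasFPowerSeriesOnBall f (FormalMultilinearSeries.ofScalars ℂ a) 0 1 := by
  refine ⟨?_, one_pos, ?_⟩
  · have := FormalMultilinearSeries.le_radius_of_bound (r := 1)
      (FormalMultilinearSeries.ofScalars ℂ a) C ?_
    · simpa using this
    · intro n
      simpa using ha n
  · intro y hy
    have hy' : ‖y‖ < 1 := by
      simpa [← ofReal_norm, ENNReal.ofReal_lt_one] using hy
    simpa [FormalMultilinearSeries.ofScalars_apply_eq, mul_comm] using h y hy'

lemma coeff_eq_of_hasSum {f : ℂ → ℂ} {a b : ℕ → ℂ} {C : ℝ} (ha : ∀ k, ‖a k‖ ≤ C)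
    (hb : ∀ k, ‖b k‖ ≤ C)
    (hfa : ∀ z : ℂ, ‖z‖ < 1 → HasSum (fun k => a k * z ^ k) (f z))
    (hfb : ∀ z : ℂ, ‖z‖ < 1 → HasSum (fun k => b k * z ^ k) (f z)) : a = b :=
  FormalMultilinearSeries.ofScalars_series_injective ℂ ℂ
    ((hasFPowerSeriesOnBall_of_hasSum ha hfa).hasFPowerSeriesAt.eq_formalMultilinearSeries
      (hasFPowerSeriesOnBall_of_hasSum hb hfb).hasFPowerSeriesAt)

/-- The moment generating function `∫ 1 / (1 - x z) dρ(x)`. -/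
def mgf (ρ : Measure Circle) (z : ℂ) : ℂ := ∫ x : Circle, 1 / (1 - x * z) ∂ρ

lemma continuous_inv_one_sub_mul {z : ℂ} (hz : ‖z‖ < 1) :
    Continuous fun x : Circle => 1 / (1 - (x : ℂ) * z) :=
  continuous_const.div (by fun_prop)
    fun _ => one_sub_ne_zero_of_norm_lt (norm_circle_mul_lt hz)

lemma norm_moment_le {ρ : Measure Circle} (k : ℕ) :
    ‖∫ x : Circle, (x : ℂ) ^ k ∂ρ‖ ≤ ρ.real Set.univ := by
  refine (norm_integral_le_integral_norm _).trans_eq ?_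
  simp [Circle.norm_coe]

section

variable {ρ ρ' : Measure Circle} [IsFiniteMeasure ρ] [IsFiniteMeasure ρ']

lemma hasSum_mgf {z : ℂ} (hz : ‖z‖ < 1) :
    HasSum (fun k : ℕ => (∫ x : Circle, (x : ℂ) ^ k ∂ρ) * z ^ k) (mgf ρ z) := by
  have h := hasSum_integral_of_summable_integral_norm (μ := ρ)
    (F := fun (k : ℕ) (x : Circle) => (x : ℂ) ^ k * z ^ k)
    (fun k => integrable_of_continuous (by fun_prop)) (by
      simp only [norm_mul, norm_pow, Circle.norm_coe, one_pow, one_mul, integral_const, smul_eq_mul]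
      exact (summable_geometric_of_lt_one (norm_nonneg z) hz).mul_left _)
  simp only [integral_mul_const] at h
  have hm : mgf ρ z = ∫ x : Circle, ∑' k : ℕ, (x : ℂ) ^ k * z ^ k ∂ρ := by
    refine integral_congr_ae (.of_forall fun x => ?_)
    simp only [← mul_pow, one_div]
    exact (tsum_geometric_of_norm_lt_one (norm_circle_mul_lt hz)).symm
  rwa [hm]

lemma hasFPowerSeriesOnBall_mgf :
    HasFPowerSeriesOnBall (mgf ρ)
      (FormalMultilinearSeries.ofScalars ℂ fun k => ∫ x : Circle, (x : ℂ) ^ k ∂ρ) 0 1 :=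
  hasFPowerSeriesOnBall_of_hasSum norm_moment_le fun _ hz => hasSum_mgf hz

lemma differentiableOn_mgf : DifferentiableOn ℂ (mgf ρ) (Metric.ball 0 1) := by
  have := (hasFPowerSeriesOnBall_mgf (ρ := ρ)).differentiableOn
  rwa [← ENNReal.ofReal_one, Metric.eball_ofReal] at this

/-- Finite measures on the circle are determined by their moment generating functions. -/
theorem ext_of_mgf (h : ∀ z : ℂ, ‖z‖ < 1 → mgf ρ z = mgf ρ' z) : ρ = ρ' := by
  refine ext_of_moments fun k => ?_
  refine congrFun (coeff_eq_of_hasSum (f := mgf ρ) (C := max (ρ.real Set.univ) (ρ'.real Set.univ))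
    (fun k => (norm_moment_le k).trans (le_max_left _ _))
    (fun k => (norm_moment_le k).trans (le_max_right _ _))
    (fun z hz => hasSum_mgf hz) fun z hz => ?_) k
  rw [h z hz]
  exact hasSum_mgf hz

end

lemma mgf_zero {ρ : Measure Circle} : mgf ρ 0 = ρ.real Set.univ := by simp [mgf]

lemma haarCircle_isProbabilityMeasure : IsProbabilityMeasure haarCircle :=
  ⟨by simpa [haarCircle] using
    Measure.haarMeasure_self (K₀ := (⊤ : TopologicalSpace.PositiveCompacts Circle))⟩

lemma haarCircle_moment {k : ℕ} (hk : k ≠ 0) : ∫ x : Circle, (x : ℂ) ^ k ∂haarCircle = 0 := by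
  have hinv : ∀ y : Circle, ∫ x : Circle, (x : ℂ) ^ k ∂haarCircle =
      (y : ℂ) ^ k * ∫ x : Circle, (x : ℂ) ^ k ∂haarCircle := by
    intro y
    have : haarCircle.IsMulLeftInvariant := by unfold haarCircle; infer_instance
    rw [← integral_const_mul, ← integral_mul_left_eq_self (fun x : Circle => (x : ℂ) ^ k) y]
    simp [mul_pow]
  -- Rotation by `π / k` changes the sign of `x ^ k`, so the invariant integral equals its own
  -- negative.
  have h1 := hinv (Circle.exp (Real.pi / k))
  have h2 : ((Circle.exp (Real.pi / k) : Circle) : ℂ) ^ k = -1 := by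
    rw [← Circle.coe_pow, ← Circle.exp_natCast_mul]
    rw [mul_div_cancel₀ _ (by exact_mod_cast hk : (k : ℝ) ≠ 0), Circle.coe_exp,
      Complex.exp_pi_mul_I]
  rw [h2] at h1
  linear_combination h1 / 2

/-! ### The transform `F` as a bounded analytic function -/

section Probability

variable {μ ν : Measure Circle} [IsProbabilityMeasure μ] [IsProbabilityMeasure ν]

lemma one_add_psi {z : ℂ} (hz : ‖z‖ < 1) : 1 + psi μ z = mgf μ z := by
  have h1 : (1 : ℂ) = ∫ _ : Circle, (1 : ℂ) ∂μ := by simp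
  have hc : Continuous fun x : Circle => ((x : ℂ) * z) / (1 - x * z) :=
    Continuous.div (by fun_prop) (by fun_prop)
      fun _ => one_sub_ne_zero_of_norm_lt (norm_circle_mul_lt hz)
  conv_lhs => rw [h1]
  rw [psi, mgf, ← integral_add (integrable_of_continuous continuous_const)
    (integrable_of_continuous hc)]
  refine integral_congr_ae (.of_forall fun x => ?_)
  have := one_sub_ne_zero_of_norm_lt (norm_circle_mul_lt (x := x) hz)
  simp only
  field_simp
  ring

lemma half_le_re_mgf {z : ℂ} (hz : ‖z‖ < 1) : 1 / 2 ≤ (mgf μ z).re := by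
  have hi := integrable_of_continuous (ρ := μ) (continuous_inv_one_sub_mul hz)
  have h : (mgf μ z).re = ∫ x : Circle, (1 / (1 - (x : ℂ) * z)).re ∂μ :=
    (integral_re hi).symm
  rw [h]
  calc (1 / 2 : ℝ) = ∫ _ : Circle, (1 / 2 : ℝ) ∂μ := by simp
    _ ≤ _ := integral_mono (integrable_const _) hi.re fun x =>
      (half_lt_re_inv_one_sub (norm_circle_mul_lt hz)).le

lemma mgf_ne_zero {z : ℂ} (hz : ‖z‖ < 1) : mgf μ z ≠ 0 := by
  intro h
  have := half_le_re_mgf (μ := μ) hz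
  rw [h] at this
  norm_num at this

lemma mgf_zero_eq_one : mgf μ 0 = 1 := by simp [mgf_zero]

/-- The function `z ↦ z F_μ(z)`. -/
def etaTransform (μ : Measure Circle) (z : ℂ) : ℂ := (mgf μ z - 1) / mgf μ z

lemma differentiableOn_eta : DifferentiableOn ℂ (etaTransform μ) (Metric.ball 0 1) :=
  (differentiableOn_mgf.sub_const 1).div differentiableOn_mgf
    fun _ hz => mgf_ne_zero (mem_ball_zero_iff.1 hz)

lemma eta_zero : etaTransform μ 0 = 0 := by simp [etaTransform, mgf_zero_eq_one]

/-- For a complex number `m`, `|m - 1| ≤ |m|` is the same as `Re m ≥ 1/2`. -/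
lemma norm_eta_le {z : ℂ} (hz : ‖z‖ < 1) : ‖etaTransform μ z‖ ≤ 1 := by
  rw [etaTransform, norm_div]
  refine div_le_one_of_le₀ ?_ (norm_nonneg _)
  rw [← sq_le_sq₀ (norm_nonneg _) (norm_nonneg _), ← Complex.normSq_eq_norm_sq,
    ← Complex.normSq_eq_norm_sq, Complex.normSq_apply, Complex.normSq_apply]
  have := half_le_re_mgf (μ := μ) hz
  simp only [Complex.sub_re, Complex.sub_im, Complex.one_re, Complex.one_im]
  nlinarith

/-- Off the origin `F` is the difference quotient of `etaTransform μ`, which vanishes at 0, so the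
limit defining `F μ 0` is a derivative. Analyticity and the Schwarz lemma thereby become available
for `F`. -/
lemma F_eq_dslope {z : ℂ} (hz : ‖z‖ < 1) : F μ z = dslope (etaTransform μ) 0 z := by
  have hpre : ∀ w : ℂ, ‖w‖ < 1 → w ≠ 0 → preF μ w = slope (etaTransform μ) 0 w := by
    intro w hw _
    have h1 := one_add_psi (μ := μ) hw
    rw [preF, h1, slope_def_field, eta_zero, etaTransform, ← h1]
    ring
  rcases eq_or_ne z 0 with rfl | h0
  · rw [F, Function.update_self, dslope_same]
    refine Tendsto.limUnder_eq ?_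
    have hd : HasDerivAt (etaTransform μ) (deriv (etaTransform μ) 0) 0 :=
      (differentiableOn_eta.differentiableAt (Metric.ball_mem_nhds 0 one_pos)).hasDerivAt
    refine (hasDerivAt_iff_tendsto_slope.1 hd).congr' ?_
    have : ∀ᶠ w : ℂ in 𝓝[≠] 0, ‖w‖ < 1 := by
      refine nhdsWithin_le_nhds ?_
      simpa [Metric.ball, dist_zero_right] using Metric.ball_mem_nhds (0 : ℂ) one_pos
    filter_upwards [this, self_mem_nhdsWithin] with w hw hw0
    exact (hpre w hw hw0).symm
  · rw [F, Function.update_of_ne h0, dslope_of_ne _ h0, hpre z hz h0]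

lemma differentiableOn_F : DifferentiableOn ℂ (F μ) (Metric.ball 0 1) :=
  ((Complex.differentiableOn_dslope (Metric.ball_mem_nhds 0 one_pos)).2
    (differentiableOn_eta (μ := μ))).congr fun _ hz => F_eq_dslope (mem_ball_zero_iff.1 hz)

lemma norm_F_le {z : ℂ} (hz : ‖z‖ < 1) : ‖F μ z‖ ≤ 1 := by
  rw [F_eq_dslope hz]
  have := Complex.norm_dslope_le_div_of_mapsTo_ball (R₂ := 1) (differentiableOn_eta (μ := μ))
    (fun w hw => by
      rw [eta_zero, mem_closedBall_zero_iff]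
      exact norm_eta_le (mem_ball_zero_iff.1 hw)) (mem_ball_zero_iff.2 hz)
  simpa using this

lemma mul_F {z : ℂ} (hz : ‖z‖ < 1) : z * F μ z = etaTransform μ z := by
  have := sub_smul_dslope (etaTransform μ) 0 z
  rw [F_eq_dslope hz]
  simpa [eta_zero] using this

lemma mgf_mul_one_sub {z : ℂ} (hz : ‖z‖ < 1) : mgf μ z * (1 - z * F μ z) = 1 := by
  rw [mul_F hz, etaTransform]
  have := mgf_ne_zero (μ := μ) hz
  field_simp
  ring

lemma eq_on_ball_of_eq_off_zero {f g : ℂ → ℂ} (hf : ContinuousOn f (Metric.ball 0 1))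
    (hg : ContinuousOn g (Metric.ball 0 1))
    (h : ∀ z : ℂ, ‖z‖ < 1 → z ≠ 0 → f z = g z) {z : ℂ} (hz : ‖z‖ < 1) : f z = g z := by
  rcases eq_or_ne z 0 with rfl | h0
  · have hb : Metric.ball (0 : ℂ) 1 ∈ 𝓝 0 := Metric.ball_mem_nhds 0 one_pos
    refine tendsto_nhds_unique_of_eventuallyEq (l := 𝓝[≠] 0)
      ((hf.continuousAt hb).tendsto.mono_left nhdsWithin_le_nhds)
      ((hg.continuousAt hb).tendsto.mono_left nhdsWithin_le_nhds) ?_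
    filter_upwards [nhdsWithin_le_nhds hb, self_mem_nhdsWithin] with w hw hw0
    exact h w (mem_ball_zero_iff.1 hw) hw0
  · exact h z hz h0

/-- `F_μ` is characterised by `∫ 1 / (1 - x z) dμ(x) = 1 / (1 - z F_μ(z))`. -/
lemma F_eq_of_mgf {G : ℂ → ℂ} (hG : ContinuousOn G (Metric.ball 0 1))
    (h : ∀ z : ℂ, ‖z‖ < 1 → mgf μ z * (1 - z * G z) = 1) {z : ℂ} (hz : ‖z‖ < 1) :
    F μ z = G z := by
  refine eq_on_ball_of_eq_off_zero differentiableOn_F.continuousOn hG (fun z hz h0 => ?_) hz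
  have h1 := mul_left_cancel₀ (mgf_ne_zero hz) ((mgf_mul_one_sub hz).trans (h z hz).symm)
  exact mul_left_cancel₀ h0 (by linear_combination -h1)

theorem ext_of_F (h : ∀ z : ℂ, ‖z‖ < 1 → F μ z = F ν z) : μ = ν := by
  refine ext_of_mgf fun z hz => ?_
  have h1 := mgf_mul_one_sub (μ := μ) hz
  have h2 := mgf_mul_one_sub (μ := ν) hz
  rw [← h z hz] at h2
  exact mul_right_cancel₀ (right_ne_zero_of_mul_eq_one h1) (h1.trans h2.symm)

/-- If `F` vanishes, the generating function is constantly 1, as it is for Haar measure, whose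
moments of positive order vanish. -/
lemma eq_haarCircle_of_F_eq_zero (h : ∀ z : ℂ, ‖z‖ < 1 → F μ z = 0) : μ = haarCircle := by
  have := haarCircle_isProbabilityMeasure
  refine ext_of_mgf fun z hz => ?_
  have h1 := mgf_mul_one_sub (μ := μ) hz
  rw [h z hz, mul_zero, sub_zero, mul_one] at h1
  rw [h1]
  have h2 := hasSum_mgf (ρ := haarCircle) hz
  refine HasSum.unique ?_ h2
  convert hasSum_single (α := ℂ) (f := fun k : ℕ => (∫ x : Circle, (x : ℂ) ^ k ∂haarCircle) * z ^ k) 0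
    (fun k hk => by rw [haarCircle_moment hk, zero_mul]) using 1
  simp

end Probability

/-! ### Factorization of alternating words -/

section Words

variable {H : Type} [NormedAddCommGroup H] [InnerProductSpace ℂ H]
  {φ : (H →L[ℂ] H) →ₗ[ℂ] ℂ} {X Y : H →L[ℂ] H}

/-- `W = X ^ n₁ Y ^ m₁ ⋯ X ^ n_k Y ^ m_k X ^ a Y ^ b` where only the first and the last exponents
may vanish. -/
structure IsAlternating (X Y W : H →L[ℂ] H) (k : ℕ) (n m : Fin k → ℕ) (a b : ℕ) : Prop where
  left : ∀ l : Fin k, 0 < (l : ℕ) → 1 ≤ n l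
  right : ∀ l : Fin k, 1 ≤ m l
  last : 0 < k → 1 ≤ a
  eq : W = (List.ofFn fun l => X ^ n l * Y ^ m l).prod * (X ^ a * Y ^ b)

lemma BooleanIndependent.map_alternating (h : BooleanIndependent φ X Y) {W : H →L[ℂ] H} {k : ℕ}
    {n m : Fin k → ℕ} {a b : ℕ} (hW : IsAlternating X Y W k n m a b) :
    φ W = (∏ l, φ (X ^ n l) * φ (Y ^ m l)) * (φ (X ^ a) * φ (Y ^ b)) := by
  have := h (k + 1) (Fin.snoc n a) (Fin.snoc m b) (fun l => ?_) (fun l => ?_)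
  · rw [List.ofFn_succ', Fin.prod_univ_castSucc] at this
    simpa [hW.eq] using this
  · induction l using Fin.lastCases with
    | last => simpa using hW.last
    | cast l => simpa using hW.left l
  · induction l using Fin.lastCases with
    | last => simp
    | cast l => exact fun _ => by simpa using hW.right l

lemma IsAlternating.snoc {W : H →L[ℂ] H} {k : ℕ} {n m : Fin k → ℕ} {a b : ℕ}
    (hW : IsAlternating X Y W k n m a b) (hb : 1 ≤ b) {N : ℕ} (hN : 1 ≤ N) :
    IsAlternating X Y (W * X ^ N) (k + 1) (Fin.snoc n a : Fin (k + 1) → ℕ)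
      (Fin.snoc m b : Fin (k + 1) → ℕ) N 0 where
  left l := by
    induction l using Fin.lastCases with
    | last => simpa using hW.last
    | cast l => simpa using hW.left l
  right l := by
    induction l using Fin.lastCases with
    | last => simpa using hb
    | cast l => simpa using hW.right l
  last _ := hN
  eq := by
    rw [List.ofFn_succ']
    simp [hW.eq]

lemma IsAlternating.mul_right {W : H →L[ℂ] H} {k : ℕ} {n m : Fin k → ℕ} {a b : ℕ}
    (hW : IsAlternating X Y W k n m a b) (N : ℕ) :
    IsAlternating X Y (W * Y ^ N) k n m a (b + N) where
  left := hW.left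
  right := hW.right
  last := hW.last
  eq := by rw [hW.eq, pow_add]; simp only [mul_assoc]

lemma IsAlternating.exists_mul_left {W : H →L[ℂ] H} {k : ℕ} {n m : Fin k → ℕ} {a b : ℕ}
    (hW : IsAlternating X Y W k n m a b) :
    ∃ (k' : ℕ) (n' m' : Fin k' → ℕ) (a' : ℕ), IsAlternating X Y (W * X) k' n' m' a' 0 := by
  rcases Nat.eq_zero_or_pos b with rfl | hb
  · refine ⟨k, n, m, a + 1, hW.left, hW.right, fun _ => Nat.succ_pos _, ?_⟩
    rw [hW.eq, pow_succ]
    simp [mul_assoc]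
  · exact ⟨_, _, _, _, by simpa using hW.snoc hb le_rfl⟩

lemma exists_isAlternating {W : H →L[ℂ] H} (hW : W ∈ Submonoid.closure ({X, Y} : Set (H →L[ℂ] H))) :
    ∃ (k : ℕ) (n m : Fin k → ℕ) (a b : ℕ), IsAlternating X Y W k n m a b := by
  induction hW using Submonoid.closure_induction_right with
  | one => exact ⟨0, Fin.elim0, Fin.elim0, 0, 0, fun l => l.elim0, fun l => l.elim0, by simp,
      by simp⟩
  | mul_right W _ Z hZ ih =>
    obtain ⟨k, n, m, a, b, h⟩ := ih
    rcases hZ with rfl | hZ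
    · obtain ⟨k', n', m', a', h'⟩ := h.exists_mul_left
      exact ⟨k', n', m', a', 0, h'⟩
    · rw [Set.mem_singleton_iff] at hZ
      subst hZ
      exact ⟨k, n, m, a, b + 1, by simpa using h.mul_right 1⟩

/-- A power of `X` following a letter `Y` opens a new block, so its moment splits off. This rule and
its mirror image are all that the resolvent computation uses of independence. -/
lemma BooleanIndependent.map_mul_pow_left (h : BooleanIndependent φ X Y) (h1 : φ 1 = 1)
    {W : H →L[ℂ] H} (hW : W ∈ Submonoid.closure ({X, Y} : Set (H →L[ℂ] H))) (N : ℕ) :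
    φ (W * Y * X ^ N) = φ (W * Y) * φ (X ^ N) := by
  obtain ⟨k, n, m, a, b, hA⟩ := exists_isAlternating hW
  -- An interior block may not be empty, so `N = 0` is separate; in the mirror rule the power of `Y`
  -- is the last exponent, which may vanish.
  rcases Nat.eq_zero_or_pos N with rfl | hN
  · simp [h1]
  have hY := hA.mul_right 1
  rw [pow_one] at hY
  rw [h.map_alternating (hY.snoc (Nat.succ_pos _) hN), h.map_alternating hY,
    Fin.prod_univ_castSucc]
  simp [h1]

lemma BooleanIndependent.map_mul_pow_right (h : BooleanIndependent φ X Y) (h1 : φ 1 = 1)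
    {W : H →L[ℂ] H} (hW : W ∈ Submonoid.closure ({X, Y} : Set (H →L[ℂ] H))) (N : ℕ) :
    φ (W * X * Y ^ N) = φ (W * X) * φ (Y ^ N) := by
  obtain ⟨k, n, m, a, b, hA⟩ := exists_isAlternating hW
  obtain ⟨k, n, m, a, hX⟩ := hA.exists_mul_left
  rw [h.map_alternating (hX.mul_right N), h.map_alternating hX]
  simp [h1, mul_assoc]

end Words

/-! ### The expectation of the resolvent of a product -/

section Resolvents

variable {A : Type*} [NormedRing A] [NormedAlgebra ℂ A] {φ : A →L[ℂ] ℂ} {X Y : A}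

/-- Right factorization extends from powers to the closed algebras. -/
lemma map_mul_of_mem_closure {s : Set A}
    (h : ∀ W ∈ Submonoid.closure s, ∀ N : ℕ, φ (W * Y * X ^ N) = φ (W * Y) * φ (X ^ N))
    {S a : A} (hS : S ∈ (Algebra.adjoin ℂ s).topologicalClosure)
    (ha : a ∈ (Algebra.adjoin ℂ {X}).topologicalClosure) :
    φ (S * Y * a) = φ (S * Y) * φ a := by
  have h1 : ∀ S ∈ Algebra.adjoin ℂ s, ∀ N : ℕ, φ (S * Y * X ^ N) = φ (S * Y) * φ (X ^ N) := by
    intro S hS N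
    rw [← Subalgebra.mem_toSubmodule, Algebra.adjoin_eq_span] at hS
    induction hS using Submodule.span_induction with
    | mem W hW => exact h W hW N
    | zero => simp
    | add a b _ _ ha hb => simp only [add_mul, map_add, ha, hb]
    | smul c a _ ha =>
      simp only [smul_mul_assoc, map_smul, ha, smul_eq_mul]
      ring
  have h2 : ∀ S ∈ Algebra.adjoin ℂ s, ∀ a ∈ Algebra.adjoin ℂ {X},
      φ (S * Y * a) = φ (S * Y) * φ a := by
    intro S hS a ha
    rw [← Subalgebra.mem_toSubmodule, Algebra.adjoin_eq_span,
      ← Submonoid.powers_eq_closure] at ha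
    induction ha using Submodule.span_induction with
    | mem W hW =>
      obtain ⟨N, rfl⟩ := hW
      exact h1 S hS N
    | zero => simp
    | add a b _ _ ha hb => simp only [mul_add, map_add, ha, hb]
    | smul c a _ ha =>
      simp only [mul_smul_comm, map_smul, ha, smul_eq_mul]
      ring
  have h3 : ∀ S ∈ Algebra.adjoin ℂ s, φ (S * Y * a) = φ (S * Y) * φ a := by
    intro S hS
    have hc : IsClosed {a | φ (S * Y * a) = φ (S * Y) * φ a} :=
      isClosed_eq (by fun_prop) (by fun_prop)
    exact closure_minimal (fun a ha => h2 S hS a ha) hc ha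
  have hc : IsClosed {S | φ (S * Y * a) = φ (S * Y) * φ a} :=
    isClosed_eq (by fun_prop) (by fun_prop)
  exact closure_minimal (fun S hS => h3 S hS) hc hS

/-- The vacuum expectation of the resolvent of `(1 + X) (1 + Y)`. -/
lemma map_resolvent_eq (h1 : φ 1 = 1)
    (hl : ∀ W ∈ Submonoid.closure ({X, Y} : Set A), ∀ N : ℕ,
      φ (W * Y * X ^ N) = φ (W * Y) * φ (X ^ N))
    (hr : ∀ W ∈ Submonoid.closure ({X, Y} : Set A), ∀ N : ℕ,
      φ (W * X * Y ^ N) = φ (W * X) * φ (Y ^ N))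
    {z : ℂ} {R S G : A}
    (hR : (1 - z • (1 + X)) * R = 1) (hRm : R ∈ (Algebra.adjoin ℂ {X}).topologicalClosure)
    (hS : (1 - z • (1 + Y)) * S = 1) (hSm : S ∈ (Algebra.adjoin ℂ {Y}).topologicalClosure)
    (hG : G * (1 - z • ((1 + X) * (1 + Y))) = 1)
    (hGm : G ∈ (Algebra.adjoin ℂ {X, Y}).topologicalClosure)
    {f g ω : ℂ} (hf : φ R * (1 - z * f) = 1) (hg : φ S * (1 - z * g) = 1)
    (hω : ω * (1 - z * (f * g)) = 1) : φ G = ω := by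
  -- In the Hilbert space model, `ω + p + q` applied to the vacuum solves `(1 - z U V) v = Ω`, where
  -- `p` and `q` are the centred parts generated by `X` and `Y`. The coefficients of `R` and `S` are
  -- those making `φ p = φ q = 0`.
  set p : A := (ω * g - z * ω * g * f) • R - (ω * g) • (1 : A) with hp
  set q : A := (ω - z * ω * g) • S - ω • (1 : A) with hq
  have hpφ : φ p = 0 := by
    simp only [hp, map_sub, map_smul, h1, smul_eq_mul]
    linear_combination ω * g * hf
  have hqφ : φ q = 0 := by
    simp only [hq, map_sub, map_smul, h1, smul_eq_mul]
    linear_combination ω * hg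
  have hpm : p ∈ (Algebra.adjoin ℂ {X}).topologicalClosure :=
    sub_mem (Subalgebra.smul_mem _ hRm _) (Subalgebra.smul_mem _ (one_mem _) _)
  have hqm : q ∈ (Algebra.adjoin ℂ {Y}).topologicalClosure :=
    sub_mem (Subalgebra.smul_mem _ hSm _) (Subalgebra.smul_mem _ (one_mem _) _)
  have hpe : z • ((1 + X) * ((ω * g) • (1 : A) + p)) = p + (ω - 1) • (1 : A) := by
    have : z • ((1 + X) * R) = R - 1 := by
      rw [sub_mul, one_mul, smul_mul_assoc] at hR
      exact eq_sub_of_add_eq' (sub_eq_iff_eq_add.1 hR).symm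
    rw [hp, add_sub_cancel, mul_smul_comm, smul_comm, this, smul_sub]
    have hω' : ω - 1 = z * ω * g * f := by linear_combination hω
    rw [hω']
    module
  have hqe : z • ((1 + Y) * (ω • (1 : A) + q)) = (z * ω * g) • (1 : A) + q := by
    have : z • ((1 + Y) * S) = S - 1 := by
      rw [sub_mul, one_mul, smul_mul_assoc] at hS
      exact eq_sub_of_add_eq' (sub_eq_iff_eq_add.1 hS).symm
    rw [hq, add_sub_cancel, mul_smul_comm, smul_comm, this, smul_sub]
    module
  have hX : (1 + X) ∈ (Algebra.adjoin ℂ {X, Y}).topologicalClosure :=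
    add_mem (one_mem _) (Subalgebra.le_topologicalClosure _ (Algebra.subset_adjoin (by simp)))
  have e1 : φ (G * (1 + X) * Y * p) = 0 := by
    rw [map_mul_of_mem_closure hl (mul_mem hGm hX) hpm, hpφ, mul_zero]
  have e2 : φ (G * X * q) = 0 := by
    rw [map_mul_of_mem_closure hr hGm hqm, hqφ, mul_zero]
  set w : A := ω • (1 : A) + p + q with hw
  have hφw : φ w = ω := by simp [hw, hpφ, hqφ, h1]
  have key : G * (z • ((1 + X) * (1 + Y))) * w = G * w - G + z • (G * (1 + X) * Y * p)
      + G * X * q := by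
    have hYw : z • ((1 + Y) * w) = (z * ω * g) • (1 : A) + q + z • p + z • (Y * p) := by
      have : (1 + Y) * w = (1 + Y) * (ω • (1 : A) + q) + p + Y * p := by
        rw [hw]; noncomm_ring
      rw [this, smul_add, smul_add, hqe]
    have hXp : (1 + X) * ((z * ω * g) • (1 : A) + q + z • p) = w - 1 + X * q := by
      have : (z * ω * g) • (1 : A) + q + z • p = z • ((ω * g) • (1 : A) + p) + q := by module
      rw [this, mul_add, mul_smul_comm, hpe, hw, add_mul, one_mul, sub_smul, one_smul]
      abel
    calc G * (z • ((1 + X) * (1 + Y))) * w = G * ((1 + X) * (z • ((1 + Y) * w))) := by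
          simp only [mul_smul_comm, smul_mul_assoc, mul_assoc]
      _ = G * ((1 + X) * ((z * ω * g) • (1 : A) + q + z • p)) + G * ((1 + X) * (z • (Y * p))) := by
          rw [hYw, mul_add, mul_add]
      _ = _ := by
          rw [hXp, mul_add, mul_sub, mul_one]
          simp only [mul_smul_comm, mul_assoc]
          abel
  -- As an operator, `w` differs from `G` by terms ending in `Y * p` and `X * q`. By `e1` and `e2`
  -- the functional kills both, because `p` and `q` are centred.
  have hGw : w = G - z • (G * (1 + X) * Y * p) - G * X * q := by
    calc w = G * (1 - z • ((1 + X) * (1 + Y))) * w := by rw [hG, one_mul]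
      _ = G * w - G * (z • ((1 + X) * (1 + Y))) * w := by rw [mul_sub, mul_one, sub_mul]
      _ = _ := by rw [key]; abel
  have := congrArg φ hGw
  rw [map_sub, map_sub, map_smul, e1, e2, hφw] at this
  simpa using this.symm

end Resolvents


/-! ### Normal states and the multiplicativity of `F` -/

section NormalStates

lemma exists_geometric_resolvent {A : Type*} [NormedRing A] [NormedAlgebra ℂ A] [CompleteSpace A]
    {T : A} (hT : ‖T‖ ≤ 1) {z : ℂ} (hz : ‖z‖ < 1) :
    ∃ R : A, HasSum (fun k : ℕ => z ^ k • T ^ k) R ∧ R * (1 - z • T) = 1 ∧ (1 - z • T) * R = 1 := by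
  have h : ‖z • T‖ < 1 := by
    rw [norm_smul]
    exact (mul_le_of_le_one_right (norm_nonneg _) hT).trans_lt hz
  refine ⟨∑' k : ℕ, (z • T) ^ k, ?_, geom_series_mul_neg _ h, mul_neg_geom_series _ h⟩
  simpa only [smul_pow] using (summable_geometric_of_norm_lt_one h).hasSum

lemma mem_topologicalClosure_of_hasSum {A : Type*} [NormedRing A] [NormedAlgebra ℂ A]
    {B : Subalgebra ℂ A} {T R : A} (hT : T ∈ B) {z : ℂ}
    (hR : HasSum (fun k : ℕ => z ^ k • T ^ k) R) : R ∈ B.topologicalClosure :=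
  B.isClosed_topologicalClosure.mem_of_tendsto hR (.of_forall fun _ =>
    B.le_topologicalClosure (sum_mem fun _ _ => B.smul_mem (pow_mem hT _) _))

variable {H : Type} [NormedAddCommGroup H] [InnerProductSpace ℂ H]
  {φ : (H →L[ℂ] H) →ₗ[ℂ] ℂ} {U V : H →L[ℂ] H}

lemma IsNormalState.map_one (h : IsNormalState φ) : φ 1 = 1 := by
  obtain ⟨ξ, h1, h2⟩ := h
  refine (h2 1).unique ?_
  have := (Complex.hasSum_ofReal (f := fun n => ‖ξ n‖ ^ 2) (x := 1)).2 h1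
  simpa [inner_self_eq_norm_sq_to_K] using this

/-- Cauchy–Schwarz bounds each summand by `‖T‖ ‖ξ n‖ ^ 2`. The resulting continuity lets the
functional pass through resolvent series. -/
lemma IsNormalState.norm_map_le (h : IsNormalState φ) (T : H →L[ℂ] H) : ‖φ T‖ ≤ ‖T‖ := by
  obtain ⟨ξ, h1, h2⟩ := h
  have h3 : HasSum (fun n => ‖T‖ * ‖ξ n‖ ^ 2) ‖T‖ := by simpa using h1.mul_left ‖T‖
  rw [← (h2 T).tsum_eq]
  refine tsum_of_norm_bounded h3 fun n => ?_
  calc ‖inner ℂ (ξ n) (T (ξ n))‖ ≤ ‖ξ n‖ * ‖T (ξ n)‖ := norm_inner_le_norm _ _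
    _ ≤ ‖ξ n‖ * (‖T‖ * ‖ξ n‖) := by gcongr; exact T.le_opNorm _
    _ = _ := by ring

variable [CompleteSpace H]

lemma IsNormalState.norm_unitary (h : IsNormalState φ) (hU : U ∈ unitary (H →L[ℂ] H)) :
    ‖U‖ = 1 := by
  have : Nontrivial (H →L[ℂ] H) := ⟨1, 0, fun h0 => by
    have := h.map_one
    rw [h0, map_zero] at this
    exact zero_ne_one this⟩
  exact CStarRing.norm_of_mem_unitary hU

lemma one_sub_mul_F_mul_F_ne_zero {μ ν : Measure Circle} [IsProbabilityMeasure μ]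
    [IsProbabilityMeasure ν] {z : ℂ} (hz : ‖z‖ < 1) : 1 - z * (F μ z * F ν z) ≠ 0 := by
  refine one_sub_ne_zero_of_norm_lt ?_
  rw [norm_mul, norm_mul]
  refine (mul_le_of_le_one_right (norm_nonneg _) ?_).trans_lt hz
  exact mul_le_one₀ (norm_F_le hz) (norm_nonneg _) (norm_F_le hz)

/-- The moment generating function of the product of two boolean independent unitaries. -/
theorem hasSum_moments_mul {μ ν : Measure Circle} (h : IsNormalState φ)
    (hU : U ∈ unitary (H →L[ℂ] H)) (hV : V ∈ unitary (H →L[ℂ] H))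
    (hμ : HasDistribution φ U μ) (hν : HasDistribution φ V ν)
    (hI : BooleanIndependent φ (U - 1) (V - 1)) {z : ℂ} (hz : ‖z‖ < 1) :
    HasSum (fun k : ℕ => φ ((U * V) ^ k) * z ^ k) (1 - z * (F μ z * F ν z))⁻¹ := by
  have := hμ.1
  have := hν.1
  let Φ : (H →L[ℂ] H) →L[ℂ] ℂ := φ.mkContinuous 1 fun T => by simpa using h.norm_map_le T
  have hΦ : ∀ T, Φ T = φ T := fun _ => rfl
  have hsum : ∀ {T R : H →L[ℂ] H}, HasSum (fun k : ℕ => z ^ k • T ^ k) R →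
      HasSum (fun k : ℕ => φ (T ^ k) * z ^ k) (φ R) := by
    intro T R hR
    have := hR.map Φ Φ.continuous
    simpa only [Function.comp_def, map_smul, hΦ, smul_eq_mul, mul_comm] using this
  have hmgf : ∀ {T R : H →L[ℂ] H} {τ : Measure Circle} [IsProbabilityMeasure τ],
      HasDistribution φ T τ → HasSum (fun k : ℕ => z ^ k • T ^ k) R → φ R = mgf τ z := by
    intro T R τ _ hτ hR
    refine (hsum hR).unique ?_
    simp only [hτ.2]
    exact hasSum_mgf hz
  obtain ⟨R, hR, -, hR1⟩ := exists_geometric_resolvent (h.norm_unitary hU).le hz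
  obtain ⟨S, hS, -, hS1⟩ := exists_geometric_resolvent (h.norm_unitary hV).le hz
  obtain ⟨G, hG, hG1, -⟩ := exists_geometric_resolvent (h.norm_unitary (mul_mem hU hV)).le hz
  have eU : U = 1 + (U - 1) := by abel
  have eV : V = 1 + (V - 1) := by abel
  have memU : ∀ {s : Set (H →L[ℂ] H)}, U - 1 ∈ s → U ∈ Algebra.adjoin ℂ s := by
    intro s hs
    rw [eU]
    exact add_mem (one_mem _) (Algebra.subset_adjoin hs)
  have memV : ∀ {s : Set (H →L[ℂ] H)}, V - 1 ∈ s → V ∈ Algebra.adjoin ℂ s := by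
    intro s hs
    rw [eV]
    exact add_mem (one_mem _) (Algebra.subset_adjoin hs)
  have key := map_resolvent_eq (φ := Φ) (X := U - 1) (Y := V - 1) (z := z) (R := R) (S := S)
    (G := G) (f := F μ z) (g := F ν z) (ω := (1 - z * (F μ z * F ν z))⁻¹) h.map_one
    (fun W hW N => hI.map_mul_pow_left h.map_one hW N)
    (fun W hW N => hI.map_mul_pow_right h.map_one hW N)
    (by rwa [← eU]) (mem_topologicalClosure_of_hasSum (memU rfl) hR)
    (by rwa [← eV]) (mem_topologicalClosure_of_hasSum (memV rfl) hS)
    (by rwa [← eU, ← eV])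
    (mem_topologicalClosure_of_hasSum (mul_mem (memU (by simp)) (memV (by simp))) hG)
    (by rw [hΦ, hmgf hμ hR, mgf_mul_one_sub hz]) (by rw [hΦ, hmgf hν hS, mgf_mul_one_sub hz])
    (inv_mul_cancel₀ (one_sub_mul_F_mul_F_ne_zero hz))
  rw [← key]
  exact hsum hG

end NormalStates

/-- The transform `F` turns the boolean convolution into a product. -/
theorem IsBooleanConv.F_eq_mul {μ ν κ : Measure Circle} (h : IsBooleanConv μ ν κ) {z : ℂ}
    (hz : ‖z‖ < 1) : F κ z = F μ z * F ν z := by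
  obtain ⟨H, _, _, _, φ, U, V, hφ, hU, hV, hμ, hν, hI, hκ⟩ := h
  have := hμ.1
  have := hν.1
  have := hκ.1
  refine F_eq_of_mgf (G := fun z => F μ z * F ν z)
    (differentiableOn_F.mul differentiableOn_F).continuousOn (fun z hz => ?_) hz
  have h1 := hasSum_moments_mul hφ hU hV hμ hν hI hz
  simp only [hκ.2] at h1
  rw [(hasSum_mgf hz).unique h1]
  exact inv_mul_cancel₀ (one_sub_mul_F_mul_F_ne_zero hz)

theorem IsBooleanPower.F_eq_pow {ν κ : Measure Circle} {n : ℕ} (h : IsBooleanPower ν n κ) {z : ℂ}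
    (hz : ‖z‖ < 1) : F κ z = F ν z ^ n := by
  induction h with
  | one => rw [pow_one]
  | succ _ hc ih => rw [hc.F_eq_mul hz, ih, pow_succ]

/-! ### Unitaries with prescribed distribution -/

section Multiplication

variable (μ : Measure Circle) [IsProbabilityMeasure μ]

/-- A bounded function on the circle as an element of `L^∞`. -/
def toLpTop (f : C(Circle, ℂ)) : Lp ℂ ⊤ μ := ContinuousMap.toLp ⊤ μ ℂ f

/-- Multiplication by a continuous function on `L²(μ)`. -/
def mulOperator (f : C(Circle, ℂ)) : Lp ℂ 2 μ →L[ℂ] Lp ℂ 2 μ :=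
  (ContinuousLinearMap.mul ℂ ℂ).holderL μ ⊤ 2 2 (toLpTop μ f)

lemma coeFn_mulOperator (f : C(Circle, ℂ)) (g : Lp ℂ 2 μ) :
    mulOperator μ f g =ᵐ[μ] fun x => f x * g x := by
  have h := (ContinuousLinearMap.mul ℂ ℂ).coeFn_holder (r := 2) (toLpTop μ f) g
  have h2 : toLpTop μ f =ᵐ[μ] f := ContinuousMap.coeFn_toLp μ f
  filter_upwards [h, h2] with x hx hx2
  rw [← hx2]
  exact hx

lemma mulOperator_mul (f g : C(Circle, ℂ)) :
    mulOperator μ (f * g) = mulOperator μ f * mulOperator μ g := by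
  ext1 h
  apply Lp.ext
  filter_upwards [coeFn_mulOperator μ (f * g) h, coeFn_mulOperator μ f (mulOperator μ g h),
    coeFn_mulOperator μ g h] with x h1 h2 h3
  rw [h1, mul_apply_eq_comp, h2, h3, ContinuousMap.mul_apply, mul_assoc]

lemma mulOperator_one : mulOperator μ 1 = 1 := by
  ext1 h
  apply Lp.ext
  filter_upwards [coeFn_mulOperator μ 1 h] with x h1
  rw [h1, one_apply_eq_self, ContinuousMap.one_apply, one_mul]

lemma mulOperator_pow (f : C(Circle, ℂ)) (k : ℕ) : mulOperator μ (f ^ k) = mulOperator μ f ^ k := by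
  induction k with
  | zero => simp [mulOperator_one]
  | succ k ih => rw [pow_succ, pow_succ, mulOperator_mul, ih]

lemma star_mulOperator (f : C(Circle, ℂ)) : star (mulOperator μ f) = mulOperator μ (star f) := by
  symm
  rw [ContinuousLinearMap.star_eq_adjoint, ContinuousLinearMap.eq_adjoint_iff]
  intro g h
  rw [L2.inner_def, L2.inner_def]
  refine integral_congr_ae ?_
  filter_upwards [coeFn_mulOperator μ (star f) g, coeFn_mulOperator μ f h] with x h1 h2
  rw [h1, h2]
  simp only [RCLike.inner_apply, map_mul, ContinuousMap.star_apply, RCLike.star_def,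
    Complex.conj_conj]
  ring

/-- Every probability measure on the circle is the distribution of a unitary operator in a vector
state. -/
lemma exists_unitary_moments :
    ∃ (U : Lp ℂ 2 μ →L[ℂ] Lp ℂ 2 μ) (Ω : Lp ℂ 2 μ), U ∈ unitary (Lp ℂ 2 μ →L[ℂ] Lp ℂ 2 μ) ∧
      inner ℂ Ω Ω = (1 : ℂ) ∧
      ∀ k : ℕ, inner ℂ Ω ((U ^ k) Ω) = ∫ x : Circle, (x : ℂ) ^ k ∂μ := by
  let f : C(Circle, ℂ) := ⟨fun x => (x : ℂ), by fun_prop⟩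
  have hf : star f * f = 1 := by
    ext x
    change (starRingEnd ℂ) (x : ℂ) * (x : ℂ) = 1
    rw [← Circle.coe_inv_eq_conj, ← Circle.coe_mul, inv_mul_cancel, Circle.coe_one]
  let Ω : Lp ℂ 2 μ := ContinuousMap.toLp 2 μ ℂ 1
  have hΩ : Ω =ᵐ[μ] fun _ => (1 : ℂ) := ContinuousMap.coeFn_toLp μ 1
  have hm : ∀ k : ℕ, inner ℂ Ω ((mulOperator μ f ^ k) Ω) = ∫ x : Circle, (x : ℂ) ^ k ∂μ := by
    intro k
    rw [L2.inner_def, ← mulOperator_pow]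
    refine integral_congr_ae ?_
    filter_upwards [coeFn_mulOperator μ (f ^ k) Ω, hΩ] with x h1 h2
    have hfx : f x = x := rfl
    rw [h1, h2, ContinuousMap.pow_apply, hfx]
    simp
  refine ⟨mulOperator μ f, Ω, ?_, by simpa using hm 0, hm⟩
  rw [Unitary.mem_iff, star_mulOperator, ← mulOperator_mul, ← mulOperator_mul, mul_comm f, hf,
    mulOperator_one]
  exact ⟨rfl, rfl⟩

end Multiplication

/-! ### Boolean independence in a vector state -/

section VectorState

variable {H : Type} [NormedAddCommGroup H] [InnerProductSpace ℂ H]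

/-- The functional `T ↦ ⟪Ω, T Ω⟫`. -/
def vectorState (Ω : H) : (H →L[ℂ] H) →ₗ[ℂ] ℂ where
  toFun T := inner ℂ Ω (T Ω)
  map_add' S T := by simp
  map_smul' c T := by simp

lemma vectorState_apply (Ω : H) (T : H →L[ℂ] H) : vectorState Ω T = inner ℂ Ω (T Ω) := rfl

lemma isNormalState_vectorState {Ω : H} (hΩ : inner ℂ Ω Ω = (1 : ℂ)) :
    IsNormalState (vectorState Ω) := by
  refine ⟨fun n => if n = 0 then Ω else 0, ?_, fun T => ?_⟩
  · convert hasSum_single 0 fun n hn => ?_ using 1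
    · rw [inner_self_eq_norm_sq_to_K] at hΩ
      have : ‖Ω‖ ^ 2 = 1 := Complex.ofReal_injective (by simpa using hΩ)
      simp [this]
    · simp [hn]
  · convert hasSum_single 0 fun n hn => ?_ using 1
    · simp [vectorState_apply]
    · simp [hn]

/-- The map `v ↦ ⟪Ω, v⟫ Ω`. -/
def vacuumProjection (Ω : H) : H →L[ℂ] H := (innerSL ℂ Ω).smulRight Ω

lemma vacuumProjection_apply (Ω v : H) : vacuumProjection Ω v = inner ℂ Ω v • Ω := rfl

lemma vectorState_mul_vacuumProjection_mul (Ω : H) (S T : H →L[ℂ] H) :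
    vectorState Ω (S * (vacuumProjection Ω * T)) = vectorState Ω S * vectorState Ω T := by
  simp [vectorState_apply, vacuumProjection_apply, mul_comm]

/-- The hypotheses insert the vacuum projection at every change of letter, and the expectation of a
word with such an insertion is the product of the expectations of its two halves. -/
lemma booleanIndependent_vectorState {Ω : H} (hΩ : inner ℂ Ω Ω = (1 : ℂ)) {X Y : H →L[ℂ] H}
    (hXY : X * Y = X * (vacuumProjection Ω * Y)) (hYX : Y * X = Y * (vacuumProjection Ω * X)) :
    BooleanIndependent (vectorState Ω) X Y := by
  have h1 : vectorState Ω 1 = 1 := hΩ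
  have hpow : ∀ {A B : H →L[ℂ] H}, A * B = A * (vacuumProjection Ω * B) → ∀ {a b : ℕ}, 1 ≤ a →
      1 ≤ b → A ^ a * B ^ b = A ^ a * (vacuumProjection Ω * B ^ b) := by
    intro A B hAB a b ha hb
    obtain ⟨a, rfl⟩ := Nat.exists_eq_add_of_le' ha
    obtain ⟨b, rfl⟩ := Nat.exists_eq_add_of_le' hb
    calc A ^ (a + 1) * B ^ (b + 1) = A ^ a * (A * B) * B ^ b := by
          rw [pow_succ, pow_succ']; simp only [mul_assoc]
      _ = A ^ (a + 1) * (vacuumProjection Ω * B ^ (b + 1)) := by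
          rw [hAB, pow_succ, pow_succ']; simp only [mul_assoc]
  intro k
  induction k with
  | zero => intro n m _ _; simpa using h1
  | succ k ih =>
    intro n m hn hm
    have hhead : vectorState Ω (X ^ n 0 * Y ^ m 0) =
        vectorState Ω (X ^ n 0) * vectorState Ω (Y ^ m 0) := by
      rcases Nat.eq_zero_or_pos (n 0) with h0 | h0
      · simp [h0, h1]
      rcases Nat.eq_zero_or_pos (m 0) with h0' | h0'
      · simp [h0', h1]
      rw [hpow hXY h0 h0', vectorState_mul_vacuumProjection_mul]
    rw [List.ofFn_succ, List.prod_cons, Fin.prod_univ_succ, ← hhead,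
      ← ih (fun l => n l.succ) (fun l => m l.succ) (fun l _ => hn _ (by simp))
        (fun l hl => hm _ (by simpa using hl))]
    cases k with
    | zero => simp [h1]
    | succ k =>
      rw [List.ofFn_succ, List.prod_cons]
      have := hpow hYX (hm 0 (by simp)) (hn (Fin.succ 0) (by simp))
      rw [← vectorState_mul_vacuumProjection_mul]
      congr 1
      calc _ = X ^ n 0 * (Y ^ m 0 * X ^ n (Fin.succ 0)) * (Y ^ m (Fin.succ 0) *
            (List.ofFn fun l : Fin k => X ^ n l.succ.succ * Y ^ m l.succ.succ).prod) := by
            simp only [mul_assoc]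
        _ = _ := by
            rw [this]
            simp only [mul_assoc]

end VectorState

/-! ### The boolean product of two unitaries -/

section Ampliation

variable {K H : Type} [NormedAddCommGroup K] [InnerProductSpace ℂ K] [CompleteSpace K]
  [NormedAddCommGroup H] [InnerProductSpace ℂ H] [CompleteSpace H]

/-- The operator acting as `T` on the image of `J` and trivially on its complement. -/
def ampliation (J : K →L[ℂ] H) (T : K →L[ℂ] K) : H →L[ℂ] H :=
  1 + J ∘L (T - 1) ∘L J.adjoint

variable {J : K →L[ℂ] H}

lemma ampliation_one : ampliation J 1 = 1 := by simp [ampliation]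

lemma ampliation_sub_one (T : K →L[ℂ] K) :
    ampliation J T - 1 = J ∘L (T - 1) ∘L J.adjoint := by simp [ampliation]

lemma star_ampliation (T : K →L[ℂ] K) : star (ampliation J T) = ampliation J (star T) := by
  rw [ampliation, star_add, star_one, ContinuousLinearMap.star_eq_adjoint,
    ContinuousLinearMap.adjoint_comp, ContinuousLinearMap.adjoint_comp,
    ContinuousLinearMap.adjoint_adjoint, ← ContinuousLinearMap.star_eq_adjoint (T - 1), star_sub,
    star_one, ampliation, ContinuousLinearMap.comp_assoc]

lemma adjoint_apply_of_inner_eq (hJ : ∀ a b, inner ℂ (J a) (J b) = (inner ℂ a b : ℂ))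
    (a : K) : J.adjoint (J a) = a := by
  refine ext_inner_right ℂ fun b => ?_
  rw [ContinuousLinearMap.adjoint_inner_left, hJ]

lemma ampliation_mul (hJ : ∀ a b, inner ℂ (J a) (J b) = (inner ℂ a b : ℂ))
    (S T : K →L[ℂ] K) :
    ampliation J (S * T) = ampliation J S * ampliation J T := by
  ext v
  simp only [ampliation, add_apply, one_apply_eq_self, mul_apply_eq_comp,
    ContinuousLinearMap.comp_apply, sub_apply, map_add, map_sub, adjoint_apply_of_inner_eq hJ]
  abel

lemma ampliation_pow (hJ : ∀ a b, inner ℂ (J a) (J b) = (inner ℂ a b : ℂ))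
    (T : K →L[ℂ] K) (k : ℕ) : ampliation J (T ^ k) = ampliation J T ^ k := by
  induction k with
  | zero => simp [ampliation_one]
  | succ k ih => rw [pow_succ, pow_succ, ampliation_mul hJ, ih]

lemma ampliation_mem_unitary
    (hJ : ∀ a b, inner ℂ (J a) (J b) = (inner ℂ a b : ℂ))
    {T : K →L[ℂ] K} (hT : T ∈ unitary (K →L[ℂ] K)) :
    ampliation J T ∈ unitary (H →L[ℂ] H) := by
  rw [Unitary.mem_iff] at hT ⊢
  rw [star_ampliation, ← ampliation_mul hJ, ← ampliation_mul hJ, hT.1, hT.2, ampliation_one]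
  exact ⟨rfl, rfl⟩

lemma vectorState_ampliation (hJ : ∀ a b, inner ℂ (J a) (J b) = (inner ℂ a b : ℂ))
    (Ω : K) (T : K →L[ℂ] K) :
    vectorState (J Ω) (ampliation J T) = inner ℂ Ω (T Ω) := by
  simp [vectorState_apply, ampliation, adjoint_apply_of_inner_eq hJ, hJ]

lemma hasDistribution_ampliation
    (hJ : ∀ a b, inner ℂ (J a) (J b) = (inner ℂ a b : ℂ))
    {μ : Measure Circle} [IsProbabilityMeasure μ] {Ω : K}
    {T : K →L[ℂ] K} (h : ∀ k : ℕ, inner ℂ Ω ((T ^ k) Ω) = ∫ x : Circle, (x : ℂ) ^ k ∂μ) :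
    HasDistribution (vectorState (J Ω)) (ampliation J T) μ :=
  ⟨inferInstance, fun k => by rw [← ampliation_pow hJ, vectorState_ampliation hJ, h]⟩

/-- By `hJJ`, the adjoint of `J` sees only the component of `J' b` along `Ω`, so the vacuum
projection can be inserted between the factors. -/
lemma ampliation_sub_one_mul {K' : Type} [NormedAddCommGroup K'] [InnerProductSpace ℂ K']
    [CompleteSpace K'] {J' : K' →L[ℂ] H} {Ω : H}
    (hJJ : ∀ a b, inner ℂ (J a) (J' b) = (inner ℂ (J a) Ω * inner ℂ Ω (J' b) : ℂ))
    (S : K →L[ℂ] K) (T : K' →L[ℂ] K') :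
    (ampliation J S - 1) * (ampliation J' T - 1) =
      (ampliation J S - 1) * (vacuumProjection Ω * (ampliation J' T - 1)) := by
  have key : ∀ b, J.adjoint (J' b) = J.adjoint (vacuumProjection Ω (J' b)) := by
    intro b
    refine ext_inner_left ℂ fun a => ?_
    rw [ContinuousLinearMap.adjoint_inner_right, ContinuousLinearMap.adjoint_inner_right, hJJ,
      vacuumProjection_apply, inner_smul_right, mul_comm]
  ext v
  rw [ampliation_sub_one, ampliation_sub_one]
  simp only [mul_apply_eq_comp, ContinuousLinearMap.comp_apply]
  rw [key]

end Ampliation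

section BooleanProduct

variable {K L : Type} [NormedAddCommGroup K] [InnerProductSpace ℂ K]
  [NormedAddCommGroup L] [InnerProductSpace ℂ L]

/-- The first summand of the Hilbert space `K ⊕ L`. -/
def leftEmbedding (K L : Type) [NormedAddCommGroup K] [InnerProductSpace ℂ K]
    [NormedAddCommGroup L] [InnerProductSpace ℂ L] : K →L[ℂ] WithLp 2 (K × L) :=
  (WithLp.prodContinuousLinearEquiv 2 ℂ K L).symm.toContinuousLinearMap ∘L
    ContinuousLinearMap.inl ℂ K L

/-- The embedding of `L` into `K ⊕ L` moving the unit vector `ω` to the unit vector `Ω` of `K`. -/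
def rightEmbedding (Ω : K) (ω : L) : L →L[ℂ] WithLp 2 (K × L) :=
  (WithLp.prodContinuousLinearEquiv 2 ℂ K L).symm.toContinuousLinearMap ∘L
    ((innerSL ℂ ω).smulRight Ω).prod (1 - vacuumProjection ω)

lemma leftEmbedding_apply (a : K) : leftEmbedding K L a = WithLp.toLp 2 (a, 0) := rfl

lemma rightEmbedding_apply (Ω : K) (ω : L) (b : L) :
    rightEmbedding Ω ω b = WithLp.toLp 2 (inner ℂ ω b • Ω, b - inner ℂ ω b • ω) := rfl

lemma inner_leftEmbedding (a b : K) :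
    inner ℂ (leftEmbedding K L a) (leftEmbedding K L b) = (inner ℂ a b : ℂ) := by
  simp [leftEmbedding_apply, WithLp.prod_inner_apply]

variable {Ω : K} {ω : L}

lemma inner_rightEmbedding (hΩ : inner ℂ Ω Ω = (1 : ℂ)) (hω : inner ℂ ω ω = (1 : ℂ)) (a b : L) :
    inner ℂ (rightEmbedding Ω ω a) (rightEmbedding Ω ω b) = (inner ℂ a b : ℂ) := by
  simp only [rightEmbedding_apply, WithLp.prod_inner_apply, inner_smul_left, inner_smul_right,
    inner_sub_left, inner_sub_right, hΩ, hω, inner_conj_symm]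
  ring

lemma rightEmbedding_vacuum (hω : inner ℂ ω ω = (1 : ℂ)) :
    rightEmbedding Ω ω ω = leftEmbedding K L Ω := by
  rw [rightEmbedding_apply, leftEmbedding_apply, hω, one_smul, one_smul, sub_self]

/-- The right embedding sends the complement of `ω` into the second summand, so the two images
interact only through the shared vacuum `Ω`. -/
lemma inner_leftEmbedding_rightEmbedding (a : K) (b : L) :
    inner ℂ (leftEmbedding K L a) (rightEmbedding Ω ω b) = (inner ℂ a Ω * inner ℂ ω b : ℂ) := by
  simp [rightEmbedding_apply, leftEmbedding_apply, WithLp.prod_inner_apply, inner_smul_right,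
    mul_comm]

end BooleanProduct

/-- If `F_κ = F_μ F_ν` then `κ` is the boolean convolution of `μ` and `ν`. -/
theorem isBooleanConv_of_F_eq_mul {μ ν κ : Measure Circle} [IsProbabilityMeasure μ]
    [IsProbabilityMeasure ν] [IsProbabilityMeasure κ]
    (h : ∀ z : ℂ, ‖z‖ < 1 → F κ z = F μ z * F ν z) : IsBooleanConv μ ν κ := by
  obtain ⟨S, Ω, hS, hΩ, hSm⟩ := exists_unitary_moments μ
  obtain ⟨T, ω, hT, hω, hTm⟩ := exists_unitary_moments ν
  let J := leftEmbedding (Lp ℂ 2 μ) (Lp ℂ 2 ν)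
  let J' := rightEmbedding Ω ω
  have hJ : ∀ a b, inner ℂ (J a) (J b) = (inner ℂ a b : ℂ) := inner_leftEmbedding
  have hJ' : ∀ a b, inner ℂ (J' a) (J' b) = (inner ℂ a b : ℂ) := inner_rightEmbedding hΩ hω
  have hvac : J' ω = J Ω := rightEmbedding_vacuum hω
  have hJJ' : ∀ a b, inner ℂ (J a) (J' b) = (inner ℂ (J a) (J Ω) * inner ℂ (J Ω) (J' b) : ℂ) := by
    intro a b
    rw [← hvac, hJ', hvac, hJ]
    exact inner_leftEmbedding_rightEmbedding a b
  have hJ'J : ∀ b a, inner ℂ (J' b) (J a) = (inner ℂ (J' b) (J Ω) * inner ℂ (J Ω) (J a) : ℂ) := by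
    intro b a
    rw [← inner_conj_symm, hJJ', map_mul, inner_conj_symm, inner_conj_symm, mul_comm]
  have hvΩ : inner ℂ (J Ω) (J Ω) = (1 : ℂ) := by rw [hJ, hΩ]
  have hφ := isNormalState_vectorState hvΩ
  have hU := ampliation_mem_unitary hJ hS
  have hV := ampliation_mem_unitary hJ' hT
  have hμ : HasDistribution (vectorState (J Ω)) (ampliation J S) μ :=
    hasDistribution_ampliation hJ hSm
  have hν : HasDistribution (vectorState (J Ω)) (ampliation J' T) ν := by
    rw [← hvac]
    exact hasDistribution_ampliation hJ' hTm
  have hI : BooleanIndependent (vectorState (J Ω)) (ampliation J S - 1) (ampliation J' T - 1) :=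
    booleanIndependent_vectorState hvΩ (ampliation_sub_one_mul hJJ' S T)
      (ampliation_sub_one_mul hJ'J T S)
  refine ⟨WithLp 2 (Lp ℂ 2 μ × Lp ℂ 2 ν), inferInstance, inferInstance, inferInstance,
    vectorState (J Ω), ampliation J S, ampliation J' T, hφ, hU, hV, hμ, hν, hI,
    inferInstance, fun k => ?_⟩
  -- The moments of `U V` and of `κ` are bounded by 1 and have the same generating function, hence
  -- coincide.
  refine congrFun (coeff_eq_of_hasSum (f := mgf κ) (C := 1)
    (a := fun k => vectorState (J Ω) ((ampliation J S * ampliation J' T) ^ k))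
    (b := fun k => ∫ x : Circle, (x : ℂ) ^ k ∂κ) (fun k => ?_) (fun k => ?_) (fun z hz => ?_)
    fun z hz => hasSum_mgf hz) k
  · refine (hφ.norm_map_le _).trans (hφ.norm_unitary (pow_mem (mul_mem hU hV) k)).le
  · simpa using norm_moment_le (ρ := κ) k
  · have h1 := mgf_mul_one_sub (μ := κ) hz
    rw [h z hz] at h1
    rw [eq_inv_of_mul_eq_one_left h1]
    exact hasSum_moments_mul hφ hU hV hμ hν hI hz

/-! ### Herglotz integrals and the surjectivity of `F` -/

/-- The Herglotz integral of a measure on the circle. -/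
def herglotzIntegral (ρ : Measure Circle) (z : ℂ) : ℂ := ∫ x : Circle, ((x : ℂ) + z) / (x - z) ∂ρ

lemma circle_sub_ne_zero {x : Circle} {z : ℂ} (hz : ‖z‖ < 1) : (x : ℂ) - z ≠ 0 := by
  intro h
  rw [← sub_eq_zero.1 h, Circle.norm_coe] at hz
  exact lt_irrefl _ hz

lemma continuous_herglotz_kernel {z : ℂ} (hz : ‖z‖ < 1) :
    Continuous fun x : Circle => ((x : ℂ) + z) / (x - z) :=
  Continuous.div (by fun_prop) (by fun_prop) fun _ => circle_sub_ne_zero hz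

/-- Since the kernel is a moment kernel in `x⁻¹`, Herglotz integrals reduce to `mgf` of the measure
pushed forward by inversion. -/
lemma herglotz_kernel_eq {x : Circle} {z : ℂ} (hz : ‖z‖ < 1) :
    ((x : ℂ) + z) / (x - z) = 2 * (1 / (1 - (x⁻¹ : Circle) * z)) - 1 := by
  have h1 := circle_sub_ne_zero (x := x) hz
  have h2 := one_sub_ne_zero_of_norm_lt (norm_circle_mul_lt (x := x⁻¹) hz)
  have h3 := x.coe_ne_zero
  have h4 : 1 - ((x⁻¹ : Circle) : ℂ) * z = (x - z) / x := by
    rw [Circle.coe_inv]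
    field_simp
  rw [h4]
  field_simp
  ring

lemma re_herglotz_kernel_pos {x : Circle} {z : ℂ} (hz : ‖z‖ < 1) :
    0 < (((x : ℂ) + z) / (x - z)).re := by
  have h := half_lt_re_inv_one_sub (norm_circle_mul_lt (x := x⁻¹) hz)
  rw [herglotz_kernel_eq hz, Complex.sub_re, Complex.one_re, show (2 : ℂ) = ((2 : ℝ) : ℂ) by simp,
    Complex.re_ofReal_mul]
  linarith

lemma herglotzIntegral_zero {ρ : Measure Circle} : herglotzIntegral ρ 0 = ρ.real Set.univ := by
  simp [herglotzIntegral]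

section

variable {ρ ρ' : Measure Circle} [IsFiniteMeasure ρ] [IsFiniteMeasure ρ']

lemma herglotzIntegral_eq {z : ℂ} (hz : ‖z‖ < 1) :
    herglotzIntegral ρ z = 2 * mgf (ρ.map fun x => x⁻¹) z - ρ.real Set.univ := by
  have hc : Continuous fun x : Circle => 1 / (1 - (x⁻¹ : Circle) * z) :=
    (continuous_inv_one_sub_mul hz).comp continuous_inv
  rw [mgf, integral_map measurable_inv.aemeasurable
    (continuous_inv_one_sub_mul hz).aestronglyMeasurable]
  simp only [herglotzIntegral, herglotz_kernel_eq hz]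
  rw [integral_sub ((integrable_of_continuous hc).const_mul 2) (integrable_const 1),
    integral_const_mul]
  simp

lemma differentiableOn_herglotzIntegral :
    DifferentiableOn ℂ (herglotzIntegral ρ) (Metric.ball 0 1) :=
  ((differentiableOn_mgf.const_mul 2).sub_const (ρ.real Set.univ : ℂ)).congr
    fun _ hz => herglotzIntegral_eq (mem_ball_zero_iff.1 hz)

lemma re_herglotzIntegral {z : ℂ} (hz : ‖z‖ < 1) :
    (herglotzIntegral ρ z).re = ∫ x : Circle, (((x : ℂ) + z) / (x - z)).re ∂ρ :=
  (integral_re (integrable_of_continuous (continuous_herglotz_kernel hz))).symm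

lemma re_herglotzIntegral_nonneg {z : ℂ} (hz : ‖z‖ < 1) : 0 ≤ (herglotzIntegral ρ z).re := by
  rw [re_herglotzIntegral hz]
  exact integral_nonneg fun x => (re_herglotz_kernel_pos hz).le

/-- A finite measure on the circle is determined by its Herglotz integral. -/
theorem ext_of_herglotzIntegral
    (h : ∀ z : ℂ, ‖z‖ < 1 → herglotzIntegral ρ z = herglotzIntegral ρ' z) : ρ = ρ' := by
  have h0 := h 0 (by simp)
  rw [herglotzIntegral_zero, herglotzIntegral_zero] at h0
  have hmap : ρ.map (fun x => x⁻¹) = ρ'.map fun x => x⁻¹ := by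
    refine ext_of_mgf fun z hz => ?_
    have := h z hz
    rw [herglotzIntegral_eq hz, herglotzIntegral_eq hz, h0] at this
    linear_combination this / 2
  have := congrArg (fun τ => Measure.map (fun x : Circle => x⁻¹) τ) hmap
  simpa [Measure.map_map measurable_inv measurable_inv, Function.comp_def] using this

end

/-- The Poisson formula on a smaller disc, as an integral against a measure on the circle. -/
lemma exists_poisson_measure {h : ℂ → ℂ} (hd : DifferentiableOn ℂ h (Metric.ball 0 1))
    (hre : ∀ z : ℂ, ‖z‖ < 1 → 0 ≤ (h z).re) {r : ℝ} (hr0 : 0 < r) (hr1 : r < 1) :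
    ∃ ρ : Measure Circle, IsFiniteMeasure ρ ∧ ∀ z : ℂ, ‖z‖ < 1 →
      ∫ x : Circle, (((x : ℂ) + z) / (x - z)).re ∂ρ = (h (r * z)).re := by
  have hmaps : ∀ z : ℂ, ‖z‖ ≤ 1 → ‖(r : ℂ) * z‖ < 1 := by
    intro z hz
    rw [norm_mul, Complex.norm_real, Real.norm_of_nonneg hr0.le]
    exact (mul_le_of_le_one_right hr0.le hz).trans_lt hr1
  have hcont : ContinuousOn (fun z : ℂ => h (r * z)) (Metric.closedBall 0 1) :=
    hd.continuousOn.comp (by fun_prop) fun z hz =>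
      mem_ball_zero_iff.2 (hmaps z (mem_closedBall_zero_iff.1 hz))
  have hdc : DiffContOnCl ℂ (fun z : ℂ => h (r * z)) (Metric.ball 0 1) := by
    refine ⟨hd.comp (by fun_prop) fun z hz =>
      mem_ball_zero_iff.2 (hmaps z (mem_ball_zero_iff.1 hz).le), ?_⟩
    rwa [closure_ball _ one_ne_zero]
  -- The density of the Poisson formula for the dilated function `z ↦ h (r z)`, which is continuous
  -- up to the boundary.
  let p : ℝ → ℝ := fun θ => (2 * Real.pi)⁻¹ * (h (r * Circle.exp θ)).re
  have hp : Continuous p := by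
    refine continuous_const.mul (Complex.continuous_re.comp ?_)
    exact hcont.comp_continuous (by fun_prop) fun θ => by simp
  have hp0 : ∀ θ, 0 ≤ p θ := fun θ =>
    mul_nonneg (by positivity) (hre _ (hmaps _ (Circle.norm_coe _).le))
  let τ : Measure ℝ := (volume.restrict (Set.Ioc 0 (2 * Real.pi))).withDensity
    fun θ => ENNReal.ofReal (p θ)
  have hpi : IntegrableOn p (Set.Ioc 0 (2 * Real.pi)) :=
    (hp.integrableOn_Icc (a := 0) (b := 2 * Real.pi)).mono_set Set.Ioc_subset_Icc_self
  have hτ : IsFiniteMeasure τ := isFiniteMeasure_withDensity_ofReal hpi.2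
  refine ⟨τ.map Circle.exp, inferInstance, fun z hz => ?_⟩
  have hk : Continuous fun x : Circle => (((x : ℂ) + z) / (x - z)).re :=
    Complex.continuous_re.comp (continuous_herglotz_kernel hz)
  rw [integral_map (by fun_prop) hk.aestronglyMeasurable]
  rw [integral_withDensity_eq_integral_toReal_smul (by fun_prop) (by simp)]
  have hP := hdc.circleAverage_re_herglotzRieszKernel_smul (w := z) (mem_ball_zero_iff.2 hz)
  have hP' := congrArg Complex.re hP
  have hint : CircleIntegrable ((Complex.re ∘ herglotzRieszKernel 0 z) • fun z : ℂ => h (r * z))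
      0 1 := by
    refine ContinuousOn.circleIntegrable' ?_
    refine ContinuousOn.smul ?_ (hcont.mono ?_)
    · exact Complex.continuous_re.comp_continuousOn
        (continuousOn_herglotzRieszKernel_sphere (mem_ball_zero_iff.2 hz))
    · rw [abs_one]
      exact Metric.sphere_subset_closedBall
  rw [← Complex.reCLM_apply, ← Complex.reCLM.circleAverage_comp_comm hint] at hP'
  rw [← hP', Real.circleAverage, intervalIntegral.integral_of_le Real.two_pi_pos.le,
    smul_eq_mul, ← integral_const_mul]
  refine integral_congr_ae (.of_forall fun θ => ?_)
  have hc : circleMap 0 1 θ = Circle.exp θ := by simp [circleMap]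
  simp only [Function.comp_apply, Pi.smul_apply', hc, herglotzRieszKernel_def, sub_zero,
    Complex.reCLM_apply, Complex.real_smul, Complex.re_ofReal_mul, smul_eq_mul,
    ENNReal.toReal_ofReal (hp0 θ), p]
  ring

/-- The **Herglotz representation** of analytic functions with nonnegative real part. -/
theorem exists_herglotz_representation {h : ℂ → ℂ} (hd : DifferentiableOn ℂ h (Metric.ball 0 1))
    (hre : ∀ z : ℂ, ‖z‖ < 1 → 0 ≤ (h z).re) :
    ∃ (c : ℝ) (ρ : Measure Circle), IsFiniteMeasure ρ ∧
      ∀ z : ℂ, ‖z‖ < 1 → h z = c * Complex.I + herglotzIntegral ρ z := by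
  let r : ℕ → ℝ := fun n => 1 - 1 / ((n : ℝ) + 2)
  have hr : ∀ n, 0 < r n ∧ r n < 1 := by
    intro n
    have h1 : 0 < 1 / ((n : ℝ) + 2) := by positivity
    have h2 : 1 / ((n : ℝ) + 2) < 1 := by
      rw [div_lt_one (by positivity)]
      have : (0 : ℝ) ≤ n := n.cast_nonneg
      linarith
    exact ⟨sub_pos.2 h2, sub_lt_self _ h1⟩
  have hrt : Tendsto r atTop (𝓝 1) := by
    have h1 : Tendsto (fun n : ℕ => 1 / ((n : ℝ) + 2)) atTop (𝓝 0) :=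
      tendsto_const_nhds.div_atTop
        (tendsto_atTop_add_const_right _ _ tendsto_natCast_atTop_atTop)
    simpa [r] using h1.const_sub 1
  choose m hm hmi using fun n => exists_poisson_measure hd hre (hr n).1 (hr n).2
  let M : ℕ → FiniteMeasure Circle := fun n => ⟨m n, hm n⟩
  -- Evaluating at the origin shows that all the measures have mass `Re h(0)`, so they lie in a
  -- weakly compact set; an ultrafilter selects a limit point.
  have hmass : ∀ n, (M n).mass = (h 0).re.toNNReal := by
    intro n
    have h1 := hmi n 0 (by simp)
    simp only [add_zero, sub_zero, mul_zero, div_self (Circle.coe_ne_zero _), Complex.one_re,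
      integral_const, smul_eq_mul, mul_one] at h1
    rw [← h1, Measure.real, ENNReal.toNNReal_toReal_eq]
    rfl
  let 𝒰 : Ultrafilter ℕ := Ultrafilter.of atTop
  have h𝒰 : (𝒰 : Filter ℕ) ≤ atTop := Ultrafilter.of_le atTop
  obtain ⟨ρ, -, hρ⟩ := (isCompact_setOfPred_finiteMeasure_eq_of_compactSpace Circle
    (h 0).re.toNNReal).ultrafilter_le_nhds (𝒰.map M) (by
      rw [le_principal_iff]
      exact mem_map.2 (univ_mem' hmass))
  have hlim : Tendsto M 𝒰 (𝓝 ρ) := hρ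
  have hreal : ∀ z : ℂ, ‖z‖ < 1 → (h z).re = (herglotzIntegral (ρ : Measure Circle) z).re := by
    intro z hz
    rw [re_herglotzIntegral hz]
    let f : BoundedContinuousFunction Circle ℝ := BoundedContinuousFunction.mkOfCompact
      ⟨fun x => (((x : ℂ) + z) / (x - z)).re,
        Complex.continuous_re.comp (continuous_herglotz_kernel hz)⟩
    have h1 : Tendsto (fun n => ∫ x, f x ∂(M n : Measure Circle)) 𝒰
        (𝓝 (∫ x, f x ∂(ρ : Measure Circle))) :=
      FiniteMeasure.tendsto_iff_forall_integral_tendsto.1 hlim f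
    have h2 : ∀ n, ∫ x, f x ∂(M n : Measure Circle) = (h (r n * z)).re := fun n => hmi n z hz
    simp only [h2] at h1
    refine tendsto_nhds_unique ?_ h1
    have hz' : Tendsto (fun n => (r n : ℂ) * z) 𝒰 (𝓝 z) := by
      have : Tendsto (fun n => (r n : ℂ)) 𝒰 (𝓝 1) :=
        (Complex.continuous_ofReal.tendsto' 1 1 Complex.ofReal_one).comp (hrt.mono_left h𝒰)
      simpa using this.mul_const z
    have hcz : ContinuousAt h z :=
      (hd.differentiableAt (Metric.isOpen_ball.mem_nhds (mem_ball_zero_iff.2 hz))).continuousAt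
    exact (Complex.continuous_re.tendsto _).comp (hcz.tendsto.comp hz')
  -- An analytic function on a connected open set with zero real part is an imaginary constant.
  have han : AnalyticOnNhd ℂ (fun z => h z - herglotzIntegral (ρ : Measure Circle) z)
      (Metric.ball 0 1) :=
    (hd.sub differentiableOn_herglotzIntegral).analyticOnNhd Metric.isOpen_ball
  obtain ⟨c, hc⟩ := han.eq_re_add_const_mul_I_of_re_eq_const (c₀ := 0)
    (fun z hz => by rw [Complex.sub_re, hreal z (mem_ball_zero_iff.1 hz), sub_self])
    Metric.isOpen_ball ((convex_ball 0 1).isConnected ⟨0, Metric.mem_ball_self one_pos⟩)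
  refine ⟨c, ρ, inferInstance, fun z hz => ?_⟩
  have := hc z (mem_ball_zero_iff.2 hz)
  rw [Complex.ofReal_zero, zero_add] at this
  rw [← this, sub_add_cancel]

/-- Every analytic self-map of the closed disc is the transform `F` of a probability measure. -/
theorem exists_measure_F_eq {G : ℂ → ℂ} (hG : DifferentiableOn ℂ G (Metric.ball 0 1))
    (hG1 : ∀ z : ℂ, ‖z‖ < 1 → ‖G z‖ ≤ 1) :
    ∃ ν : Measure Circle, IsProbabilityMeasure ν ∧ ∀ z : ℂ, ‖z‖ < 1 → F ν z = G z := by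
  have hlt : ∀ z : ℂ, ‖z‖ < 1 → ‖z * G z‖ < 1 := by
    intro z hz
    rw [norm_mul]
    exact (mul_le_of_le_one_right (norm_nonneg _) (hG1 z hz)).trans_lt hz
  -- The function below is `(1 + z G) / (1 - z G)`. Its value 1 at the origin will force `c = 0` and
  -- total mass 1.
  obtain ⟨c, ρ, hρ, hrep⟩ := exists_herglotz_representation
    (h := fun z => 2 * (1 / (1 - z * G z)) - 1)
    ((((differentiableOn_const 1).div
      ((differentiableOn_const 1).sub (differentiableOn_id.mul hG)) fun z hz =>
        one_sub_ne_zero_of_norm_lt (hlt z (mem_ball_zero_iff.1 hz))).const_mul 2).sub_const 1)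
    (fun z hz => by
      have := half_lt_re_inv_one_sub (hlt z hz)
      rw [Complex.sub_re, Complex.one_re, show (2 : ℂ) = ((2 : ℝ) : ℂ) by simp,
        Complex.re_ofReal_mul]
      linarith)
  have h0 := hrep 0 (by simp)
  rw [herglotzIntegral_zero] at h0
  have hc : c = 0 := by
    have := congrArg Complex.im h0
    simpa using this.symm
  have hmass : ρ.real Set.univ = 1 := by
    have := congrArg Complex.re h0
    simp [hc] at this
    linarith
  have hprob : IsProbabilityMeasure ρ :=
    ⟨by rwa [Measure.real, ENNReal.toReal_eq_one_iff] at hmass⟩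
  have hprob' : IsProbabilityMeasure (ρ.map fun x => x⁻¹) :=
    Measure.isProbabilityMeasure_map measurable_inv.aemeasurable
  refine ⟨ρ.map fun x => x⁻¹, hprob', fun z hz => F_eq_of_mgf hG.continuousOn (fun z hz => ?_) hz⟩
  have h1 := hrep z hz
  rw [herglotzIntegral_eq hz, hmass, hc] at h1
  have h2 : mgf (ρ.map fun x => x⁻¹) z = 1 / (1 - z * G z) := by
    simp only [Complex.ofReal_zero, Complex.ofReal_one] at h1
    linear_combination -h1 / 2
  rw [h2]
  exact one_div_mul_cancel (one_sub_ne_zero_of_norm_lt (hlt z hz))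

/-! ### Logarithms, roots and characteristic pairs -/

lemma levyExponent_eq (b : ℝ) (ρ : Measure Circle) (z : ℂ) :
    levyExponent b ρ z = Complex.I * b - herglotzIntegral ρ z := rfl

lemma differentiableOn_levyExponent {b : ℝ} {ρ : Measure Circle} [IsFiniteMeasure ρ] :
    DifferentiableOn ℂ (levyExponent b ρ) (Metric.ball 0 1) :=
  differentiableOn_herglotzIntegral.const_sub (Complex.I * b)

lemma re_levyExponent_nonpos {b : ℝ} {ρ : Measure Circle} [IsFiniteMeasure ρ] {z : ℂ}
    (hz : ‖z‖ < 1) : (levyExponent b ρ z).re ≤ 0 := by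
  rw [levyExponent_eq]
  simpa using re_herglotzIntegral_nonneg hz

/-- A nonvanishing analytic function on the unit disc has an analytic logarithm. -/
lemma exists_analytic_log {f : ℂ → ℂ} (hf : DifferentiableOn ℂ f (Metric.ball 0 1))
    (h0 : ∀ z : ℂ, ‖z‖ < 1 → f z ≠ 0) :
    ∃ g : ℂ → ℂ, DifferentiableOn ℂ g (Metric.ball 0 1) ∧
      ∀ z : ℂ, ‖z‖ < 1 → f z = Complex.exp (g z) := by
  have hderiv : DifferentiableOn ℂ (fun z => deriv f z / f z) (Metric.ball 0 1) :=
    (hf.deriv Metric.isOpen_ball).div hf fun z hz => h0 z (mem_ball_zero_iff.1 hz)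
  obtain ⟨g, hg0, hg⟩ := hderiv.isExactOn_ball.with_val_at 0 (Complex.log (f 0))
  refine ⟨g, fun z hz => (hg z hz).differentiableAt.differentiableWithinAt, fun z hz => ?_⟩
  have hk : ∀ w ∈ Metric.ball (0 : ℂ) 1, HasDerivAt (fun w => f w * Complex.exp (-g w)) 0 w := by
    intro w hw
    have hfw := (hf.differentiableAt (Metric.isOpen_ball.mem_nhds hw)).hasDerivAt
    have hne := h0 w (mem_ball_zero_iff.1 hw)
    refine (hfw.mul (hg w hw).neg.cexp).congr_deriv ?_
    have hdiv := div_mul_cancel₀ (deriv f w) hne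
    rw [Pi.neg_apply]
    linear_combination -Complex.exp (-g w) * hdiv
  have hconst : f z * Complex.exp (-g z) = f 0 * Complex.exp (-g 0) :=
    Metric.isOpen_ball.is_const_of_deriv_eq_zero (convex_ball 0 1).isPreconnected
      (fun w hw => (hk w hw).differentiableAt.differentiableWithinAt)
      (fun w hw => (hk w hw).deriv) (mem_ball_zero_iff.2 hz) (Metric.mem_ball_self one_pos)
  have h00 := h0 0 (by simp)
  rw [hg0, Complex.exp_neg, Complex.exp_neg, Complex.exp_log h00, mul_inv_cancel₀ h00] at hconst
  exact (mul_inv_eq_one₀ (Complex.exp_ne_zero _)).1 hconst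

section

variable {μ : Measure Circle} [IsProbabilityMeasure μ]

lemma analyticOnNhd_F : AnalyticOnNhd ℂ (F μ) (Metric.ball 0 1) :=
  differentiableOn_F.analyticOnNhd Metric.isOpen_ball

/-- The transform of an infinitely divisible measure other than Haar measure has no zeros: a zero
would have arbitrarily high order. -/
lemma IsInfinitelyDivisible.F_ne_zero (h : IsInfinitelyDivisible μ) (hμ : μ ≠ haarCircle) {z : ℂ}
    (hz : ‖z‖ < 1) : F μ z ≠ 0 := by
  intro h0
  have hzb := mem_ball_zero_iff.2 hz
  have hle : ∀ n : ℕ, (n : ℕ∞) ≤ analyticOrderAt (F μ) z := by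
    intro n
    rcases Nat.eq_zero_or_pos n with rfl | hn
    · simp
    obtain ⟨ν, hν, hpow⟩ := h n hn
    have han : AnalyticAt ℂ (F ν) z := analyticOnNhd_F z hzb
    have heq : F μ =ᶠ[𝓝 z] F ν ^ n := by
      filter_upwards [Metric.isOpen_ball.mem_nhds hzb] with w hw
      rw [Pi.pow_apply, hpow.F_eq_pow (mem_ball_zero_iff.1 hw)]
    have hν0 : F ν z = 0 := by
      have := hpow.F_eq_pow hz
      rw [h0] at this
      exact eq_zero_of_pow_eq_zero this.symm
    rw [analyticOrderAt_congr heq, analyticOrderAt_pow han, nsmul_eq_mul]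
    have h1 : 1 ≤ analyticOrderAt (F ν) z :=
      Order.one_le_iff_ne_zero.2 (han.analyticOrderAt_ne_zero.2 hν0)
    calc (n : ℕ∞) = n * 1 := (mul_one _).symm
      _ ≤ _ := by gcongr
  have htop : analyticOrderAt (F μ) z = ⊤ := ENat.eq_top_iff_forall_ge.2 hle
  have hzero := analyticOnNhd_F.eqOn_zero_of_preconnected_of_eventuallyEq_zero
    (convex_ball 0 1).isPreconnected hzb (analyticOrderAt_eq_top.1 htop)
  exact hμ (eq_haarCircle_of_F_eq_zero fun w hw => hzero (mem_ball_zero_iff.2 hw))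

theorem IsInfinitelyDivisible.exists_isCharacteristicPair (h : IsInfinitelyDivisible μ)
    (hμ : μ ≠ haarCircle) : ∃ (b : ℝ) (ρ : Measure Circle), IsCharacteristicPair μ b ρ := by
  obtain ⟨g, hg, hFg⟩ := exists_analytic_log (differentiableOn_F (μ := μ))
    fun z hz => h.F_ne_zero hμ hz
  obtain ⟨c, ρ, hρ, hrep⟩ := exists_herglotz_representation hg.neg fun z hz => by
    have := norm_F_le (μ := μ) hz
    rw [hFg z hz, Complex.norm_exp, Real.exp_le_one_iff] at this
    simpa using this
  -- The representation is that of `-g`, so the angle is `-c`; reducing it modulo `2π` leaves the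
  -- exponential unchanged.
  refine ⟨toIcoMod Real.two_pi_pos 0 (-c), ρ, ?_, hρ, fun z hz => ?_⟩
  · simpa using toIcoMod_mem_Ico Real.two_pi_pos 0 (-c)
  · have hmod := toIcoMod_add_toIcoDiv_zsmul Real.two_pi_pos 0 (-c)
    set k := toIcoDiv Real.two_pi_pos 0 (-c)
    rw [hFg z hz, Complex.exp_eq_exp_iff_exists_int]
    refine ⟨k, ?_⟩
    have h1 := hrep z hz
    have h2 := congrArg (fun t : ℝ => (t : ℂ)) hmod
    simp only [zsmul_eq_mul, Complex.ofReal_add, Complex.ofReal_mul, Complex.ofReal_intCast,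
      Complex.ofReal_neg, Complex.ofReal_ofNat] at h2
    rw [levyExponent_eq]
    simp only [Pi.neg_apply] at h1
    linear_combination -h1 - Complex.I * h2

theorem IsCharacteristicPair.isInfinitelyDivisible {b : ℝ} {ρ : Measure Circle}
    (h : IsCharacteristicPair μ b ρ) : IsInfinitelyDivisible μ := by
  intro n hn
  have := h.2.1
  have hn0 : (n : ℂ) ≠ 0 := Nat.cast_ne_zero.2 (Nat.one_le_iff_ne_zero.1 hn)
  -- All fractional powers `j / n` are needed: `j = 1` is the root, `j = n` recovers `μ`, and the
  -- others are the intermediate convolution powers.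
  have hroot : ∀ j : ℕ, ∃ ν : Measure Circle, IsProbabilityMeasure ν ∧
      ∀ z : ℂ, ‖z‖ < 1 → F ν z = Complex.exp ((j / n : ℝ) * levyExponent b ρ z) := by
    intro j
    refine exists_measure_F_eq (differentiableOn_levyExponent.const_mul _).cexp fun z hz => ?_
    rw [Complex.norm_exp, Real.exp_le_one_iff, Complex.re_ofReal_mul]
    exact mul_nonpos_of_nonneg_of_nonpos (by positivity) (re_levyExponent_nonpos hz)
  choose ν hν hF using hroot
  have hpow : ∀ j : ℕ, IsBooleanPower (ν 1) (j + 1) (ν (j + 1)) := by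
    intro j
    induction j with
    | zero => exact .one
    | succ j ih =>
      refine ih.succ (isBooleanConv_of_F_eq_mul fun z hz => ?_)
      rw [hF _ z hz, hF _ z hz, hF _ z hz, ← Complex.exp_add]
      congr 1
      push_cast
      ring
  have hμ : ν n = μ := ext_of_F fun z hz => by
    rw [hF n z hz, h.2.2 z hz]
    congr 1
    push_cast
    rw [div_self hn0, one_mul]
  obtain ⟨j, rfl⟩ := Nat.exists_eq_add_of_le' hn
  exact ⟨ν 1, hν 1, hμ ▸ hpow j⟩

end

theorem IsCharacteristicPair.unique {μ : Measure Circle} {b b' : ℝ} {ρ ρ' : Measure Circle}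
    (h : IsCharacteristicPair μ b ρ) (h' : IsCharacteristicPair μ b' ρ') : b = b' ∧ ρ = ρ' := by
  obtain ⟨hb, hρ, hF⟩ := h
  obtain ⟨hb', hρ', hF'⟩ := h'
  have hexp : ∀ z : ℂ, ‖z‖ < 1 →
      Complex.exp (levyExponent b ρ z - levyExponent b' ρ' z) = 1 := by
    intro z hz
    rw [Complex.exp_sub, ← hF z hz, ← hF' z hz, hF z hz, div_self (Complex.exp_ne_zero _)]
  have han : AnalyticOnNhd ℂ (fun z => levyExponent b ρ z - levyExponent b' ρ' z)
      (Metric.ball 0 1) :=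
    (differentiableOn_levyExponent.sub differentiableOn_levyExponent).analyticOnNhd
      Metric.isOpen_ball
  -- Since its exponential is 1, the difference has zero real part, hence is an imaginary constant.
  obtain ⟨c, hc⟩ := han.eq_re_add_const_mul_I_of_re_eq_const (c₀ := 0)
    (fun z hz => by
      have := congrArg norm (hexp z (mem_ball_zero_iff.1 hz))
      rwa [Complex.norm_exp, norm_one, Real.exp_eq_one_iff] at this)
    Metric.isOpen_ball ((convex_ball 0 1).isConnected ⟨0, Metric.mem_ball_self one_pos⟩)
  have h0 := hc 0 (Metric.mem_ball_self one_pos)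
  simp only [levyExponent_eq, herglotzIntegral_zero] at h0
  have hcb : b - b' = c := by simpa using congrArg Complex.im h0
  have hbb : b = b' := by
    have h1 := hexp 0 (by simp)
    rw [hc 0 (Metric.mem_ball_self one_pos), Complex.ofReal_zero, zero_add,
      Complex.exp_eq_one_iff] at h1
    obtain ⟨n, hn⟩ := h1
    have hn' : c = n * (2 * Real.pi) := by simpa using congrArg Complex.im hn
    have hpi := Real.two_pi_pos
    have hlt : (n : ℝ) < 1 := by
      by_contra! hge
      nlinarith [hb.1, hb.2, hb'.1, hb'.2]
    have hgt : (-1 : ℝ) < n := by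
      by_contra! hge
      nlinarith [hb.1, hb.2, hb'.1, hb'.2]
    have hn0 : n = 0 := by
      have h1 : n < 1 := by exact_mod_cast hlt
      have h2 : -1 < n := by exact_mod_cast hgt
      omega
    rw [hn0, Int.cast_zero, zero_mul] at hn'
    linarith
  refine ⟨hbb, ext_of_herglotzIntegral fun z hz => ?_⟩
  have hz' := hc z (mem_ball_zero_iff.2 hz)
  simp only [levyExponent_eq, ← hcb, hbb, sub_self, Complex.ofReal_zero, zero_mul,
    add_zero] at hz'
  linear_combination -hz'

end BooleanUnitCircle

end

theorem theorem3p5 (μ : MeasureTheory.Measure Circle) [MeasureTheory.IsProbabilityMeasure μ]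
    (hμ : μ ≠ BooleanUnitCircle.haarCircle) :
    (BooleanUnitCircle.IsInfinitelyDivisible μ ↔
      ∃ (b : ℝ) (ρ : MeasureTheory.Measure Circle),
        BooleanUnitCircle.IsCharacteristicPair μ b ρ) ∧
    (∀ (b b' : ℝ) (ρ ρ' : MeasureTheory.Measure Circle),
      BooleanUnitCircle.IsCharacteristicPair μ b ρ →
      BooleanUnitCircle.IsCharacteristicPair μ b' ρ' → b = b' ∧ ρ = ρ') :=
  ⟨⟨fun h => h.exists_isCharacteristicPair hμ, fun ⟨_, _, h⟩ => h.isInfinitelyDivisible⟩,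
    fun _ _ _ _ h h' => h.unique h'⟩
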